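/- Let $m\ge 1$, let $x=(x_1,\dots,x_m)$ be the independent and $u=(u^1,u^2)$ the dependent variables, and let $u^a_J$ denote the derivative coordinates on jet space ($u^a_i$ for first order). Let $\Delta_1,\Delta_2$ and the multipliers $\beta^1,\beta^2$ be smooth ($C^\infty$) functions on an open subset $\Omega$ of the jet space of some order $k$, and suppose that the sub-system $G=\beta^1\Delta_1+\beta^2\Delta_2$ has maximal rank: $dG\neq 0$ at every point of $\Omega$ at which $G=0$. Let $z_0$ be a jet (of infinite order; only finitely many of its coordinates matter) whose $k$-jet lies in $\Omega$, and let $b_0$ be its underlying point $(x,u)$. Then the following two conditions are equivalent. 1. (*$G$ is decouplable near $z_0$.*) There are a smoothly invertible point transformation $\mathcal T:(x,u)\mapsto(\bar x,\bar u)=(\bar X(x,u),\bar U(x,u))$, defined near $b_0$ and with prolongation to jets defined at $z_0$ (that is, $\det(D_j\bar X^l)\neq0$ at $z_0$), and a nowhere vanishing smooth differential function $F$ near the image $\bar z_0$ of $z_0$, such that $$\frac{\partial\bigl(F\cdot(G\circ\mathcal T^{-1})\bigr)}{\partial \bar u^2_I}=0\quad\text{near }\bar z_0\text{ for all multi-indices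 } I .$$ Here $G\circ\mathcal T^{-1}$ is $G$ expressed in the transformed variables and their derivatives. That is, the transformed sub-system is decoupled in the free variable $\bar u^1$. 2. (*$G$ admits a sub-system symmetry with an arbitrary factor near $z_0$.*) There is a smooth vector field $v=\xi^i(x,u)\partial_{x_i}+\eta^a(x,u)\partial_{u^a}$ near $b_0$, whose characteristic $(\eta^a-\xi^iu^a_i)_{a=1,2}$ does not vanish at $z_0$ (that is, the corresponding canonical operator is nonzero at $z_0$), and a neighbourhood $V$ of $z_0$ such that for every smooth function $\lambda(x,u)$ on the domain of $v$ the prolongation of $$\mathrm X_\lambda=\lambda(x,u)\left[\xi^i(x,u)\frac{\partial}{\partial x_i}+\eta^a(x,u)\frac{\partial}{\partial u^a}\right]$$ satisfies $\mathrm X_\lambda G=0$ at every point of $V$ at which $G=0$. -/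

import Mathlib

open Topology
open scoped ContDiff

/-- Multi-indices `J = (J_1, …, J_m)` of length `|J| ≤ k`. -/
abbrev MultiIdx (m k : ℕ) : Type := {J : Fin m → ℕ // ∑ i, J i ≤ k}

noncomputable instance instFintypeMultiIdx (m k : ℕ) : Fintype (MultiIdx m k) :=
  Fintype.ofInjective
    (fun (J : MultiIdx m k) (i : Fin m) =>
      (⟨J.1 i, Nat.lt_succ_of_le
        ((Finset.single_le_sum (f := J.1) (fun _ _ => Nat.zero_le _) (Finset.mem_univ i)).trans
          J.2)⟩ : Fin (k + 1)))
    (fun _ _ h => Subtype.ext (funext fun i => congrArg Fin.val (congrFun h i)))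

/-- The space of the variables `(x, u)`: `m` independent variables `x_1, …, x_m` and two dependent
variables `u¹` (index `0`) and `u²` (index `1`). -/
abbrev BaseSpace (m : ℕ) : Type := (Fin m → ℝ) × (Fin 2 → ℝ)

/-- The jet space of order `k`, with coordinates `x_i` and `u^a_J`, `|J| ≤ k`. -/
abbrev Jet (m k : ℕ) : Type := (Fin m → ℝ) × (Fin 2 → MultiIdx m k → ℝ)

/-- The jet space of infinite order, with coordinates `x_i` and `u^a_J` for all `J`, and with the
product topology (so that a neighbourhood restricts only finitely many coordinates). -/
abbrev JetSpace (m : ℕ) : Type := (Fin m → ℝ) × (Fin 2 → (Fin m → ℕ) → ℝ)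

namespace JetSpace

/-- The underlying jet of order `k`. -/
def trunc {m : ℕ} (k : ℕ) (z : JetSpace m) : Jet m k := (z.1, fun a J => z.2 a J.1)

/-- The underlying point `(x, u)`. -/
def base {m : ℕ} (z : JetSpace m) : BaseSpace m := (z.1, fun a => z.2 a 0)

end JetSpace

/-- `F` is a smooth differential function near `z₀`: on a neighbourhood of `z₀` it is a smooth
function of `x` and of finitely many of the coordinates `u^a_J`. -/
def IsDiffFunAt {m : ℕ} (F : JetSpace m → ℝ) (z₀ : JetSpace m) : Prop :=
  ∃ (k : ℕ) (U : Set (Jet m k)) (f : Jet m k → ℝ),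
    IsOpen U ∧ z₀.trunc k ∈ U ∧ ContDiffOn ℝ ∞ f U ∧
      ∀ z : JetSpace m, z.trunc k ∈ U → F z = f (z.trunc k)

/-- The partial derivative `∂F / ∂u^a_J`. -/
noncomputable def partialJet {m : ℕ} (a : Fin 2) (J : Fin m → ℕ) (F : JetSpace m → ℝ)
    (z : JetSpace m) : ℝ :=
  lineDeriv ℝ F z (0, Pi.single a (Pi.single J 1))

/-- The total derivative
`D_i F = ∂F/∂x_i + ∑_{a, J} u^a_{J + e_i} ∂F/∂u^a_J`. -/
noncomputable def totalDeriv {m : ℕ} (i : Fin m) (F : JetSpace m → ℝ) (z : JetSpace m) : ℝ :=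
  lineDeriv ℝ F z (Pi.single i 1, fun a J => z.2 a (J + Pi.single i 1))

/-- `D^J = D_1^{J_1} ⋯ D_m^{J_m}` for a family of operators `D_1, …, D_m`. -/
def multiPow {m : ℕ} {α : Type*} (D : Fin m → α → α) (J : Fin m → ℕ) (F : α) : α :=
  (List.finRange m).foldr (fun i G => (D i)^[J i] G) F

/-- A vector field `v = ξ^i ∂_{x_i} + η^a ∂_{u^a}` is given by `v b = (ξ b, η b)`. Its
characteristic is `Q^a = η^a - ξ^i u^a_i`, the infinitesimal of the canonical (evolutionary)
operator that corresponds to `v`. -/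
noncomputable def characteristic {m : ℕ} (v : BaseSpace m → BaseSpace m) (a : Fin 2)
    (z : JetSpace m) : ℝ :=
  (v z.base).2 a - ∑ i, (v z.base).1 i * z.2 a (Pi.single i 1)

/-- The prolongation of `v` to the jet space, with the coefficient `D_J Q^a + ξ^i u^a_{J + e_i}`
at `∂/∂u^a_J`. -/
noncomputable def prolongField {m : ℕ} (v : BaseSpace m → BaseSpace m) (z : JetSpace m) :
    JetSpace m :=
  ((v z.base).1, fun a J =>
    multiPow totalDeriv J (characteristic v a) z
      + ∑ i, (v z.base).1 i * z.2 a (J + Pi.single i 1))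

/-- The action on `G` of the prolonged infinitesimal operator `X = ξ^i ∂_{x_i} + η^a ∂_{u^a} + ⋯`
with generator `v`. -/
noncomputable def applyField {m : ℕ} (v : BaseSpace m → BaseSpace m) (G : JetSpace m → ℝ)
    (z : JetSpace m) : ℝ :=
  lineDeriv ℝ G z (prolongField v z)

/-- The matrix `(D_j X̄^l)` of total derivatives of the new independent variables, for a map
`T = (X̄, Ū)` of the space of the variables `(x, u)`. -/
noncomputable def totalJacobian {m : ℕ} (T : BaseSpace m → BaseSpace m) (z : JetSpace m) :
    Matrix (Fin m) (Fin m) ℝ :=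
  Matrix.of fun j l => totalDeriv j (fun y => (T y.base).1 l) z

/-- The total derivative with respect to the new independent variable `x̄_l = X̄^l(x, u)`, from the
chain rule `D_j = ∑_l (D_j X̄^l) D̄_l`. -/
noncomputable def newTotalDeriv {m : ℕ} (T : BaseSpace m → BaseSpace m) (l : Fin m)
    (F : JetSpace m → ℝ) (z : JetSpace m) : ℝ :=
  ∑ j, (totalJacobian T z)⁻¹ l j * totalDeriv j F z

/-- The prolongation of the point transformation `x̄ = X̄(x, u)`, `ū = Ū(x, u)` to the jet space:
`ū^a_J = D̄_J Ū^a`. It is meaningful at `z` if the matrix `(D_j X̄^l)` is invertible at `z`. -/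
noncomputable def prolongMap {m : ℕ} (T : BaseSpace m → BaseSpace m) (z : JetSpace m) :
    JetSpace m :=
  ((T z.base).1, fun a J => multiPow (newTotalDeriv T) J (fun y => (T y.base).2 a) z)

/-- `G` is decoupled in the free variable `u¹` near `z₀`: up to a nonzero smooth factor it depends
neither on `u²` nor on the derivatives of `u²`. -/
def IsDecoupledAt {m : ℕ} (G : JetSpace m → ℝ) (z₀ : JetSpace m) : Prop :=
  ∃ F : JetSpace m → ℝ, IsDiffFunAt F z₀ ∧
    ∀ᶠ z in 𝓝 z₀, F z ≠ 0 ∧ ∀ I : Fin m → ℕ, partialJet 1 I (fun y => F y * G y) z = 0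

/-- `G` is decouplable near `z₀`: a smoothly invertible point transformation `T` of the variables
`(x, u)`, defined near the point underlying `z₀` and with prolongation defined at `z₀`, takes `G`
to a differential function `G ∘ T⁻¹` which is decoupled near the image of `z₀`. -/
def IsDecouplableAt {m : ℕ} (G : JetSpace m → ℝ) (z₀ : JetSpace m) : Prop :=
  ∃ T : OpenPartialHomeomorph (BaseSpace m) (BaseSpace m),
    z₀.base ∈ T.source ∧ ContDiffOn ℝ ∞ T T.source ∧ ContDiffOn ℝ ∞ T.symm T.target ∧
    IsUnit (totalJacobian T z₀).det ∧
    IsDecoupledAt (fun z => G (prolongMap T.symm z)) (prolongMap T z₀)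

/-- Near `z₀` the equation `G = 0` admits the symmetries
`X_c = c(x, u) [ξ^i(x, u) ∂_{x_i} + η^a(x, u) ∂_{u^a}]` with an arbitrary smooth function `c`, for
some smooth vector field `v = (ξ, η)` near the point underlying `z₀` such that the canonical
operator corresponding to `v` does not vanish at `z₀`. -/
def AdmitsArbitrarySymmetryAt {m : ℕ} (G : JetSpace m → ℝ) (z₀ : JetSpace m) : Prop :=
  ∃ (B : Set (BaseSpace m)) (v : BaseSpace m → BaseSpace m) (V : Set (JetSpace m)),
    IsOpen B ∧ ContDiffOn ℝ ∞ v B ∧ IsOpen V ∧ z₀ ∈ V ∧ (∀ z ∈ V, z.base ∈ B) ∧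
    (∃ a, characteristic v a z₀ ≠ 0) ∧
    ∀ c : BaseSpace m → ℝ, ContDiffOn ℝ ∞ c B →
      ∀ z ∈ V, G z = 0 → applyField (fun b => c b • v b) G z = 0

/-- The sub-system `β^1 Δ_1 + β^2 Δ_2` as a function on the jet space of order `k`. -/
def subsystem {m k : ℕ} (β Δ : Fin 2 → Jet m k → ℝ) (p : Jet m k) : ℝ := ∑ i, β i p * Δ i p

/-! Both conditions are invariant under point transformations, because prolongation of vector fields
is natural (`RegularOn.pushDirection_prolongField`). So everything can be read off in coordinates
where the field is `∂/∂u²`. There the prolongation of `c ∂/∂u²` is the sum over `J` of `D_J c ·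
∂/∂u²_J`.

From decoupling to symmetry: pull `∂/∂ū²` back to a field `v`. Every multiple `c v` prolongs to a
combination of the `∂/∂ū²_J`, which kills `F · Ḡ` (with `Ḡ` for `G` in the new variables). By the
product rule it kills `Ḡ` wherever `Ḡ = 0`. The characteristic of `v` is nonzero: otherwise `v`
would be a combination of total-derivative directions, and invertibility of `(D_j X̄^l)` would force
`v = 0`.

From symmetry to decoupling: a flow box turns `v` into `∂/∂ū²`. The nonzero characteristic allows
its differential to be chosen so that `(D_j X̄^l)` is the identity at `z₀`, so the transformation
prolongs there. Testing with `c = exp (∑ t_i x̄_i)`, for which `D_J c = t^J c`, shows that the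
polynomial `∑_J t^J ∂Ḡ/∂ū²_J` vanishes for all `t` at each zero of `Ḡ`. Hence every `∂Ḡ/∂ū²_J`
vanishes on `Ḡ = 0`.

It remains to produce the factor (`exists_factor_of_fderiv_eq_zero_on_ker`). By maximal rank these
derivatives are smooth multiples of `Ḡ` (`exists_smooth_quotient`), and Grönwall's inequality then
makes the zero set invariant along the `u²` directions. So `Ḡ` with its `u²` coordinates frozen
vanishes wherever `Ḡ` does, and it equals `F Ḡ`; comparing differentials gives `F ≠ 0`. Away from
the zero set `F = 1/Ḡ` works.

The analytic input, namely smooth dependence of segment integrals and of flows on their data, comes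
from the smoothness of `γ ↦ f ∘ γ` on `C([0,1], E)` and the inverse function theorem. -/

/-! ### Superposition operators on spaces of continuous curves -/

section Superposition

open ContinuousMap

universe u

lemma continuous_curveExtend {F : Type u} [TopologicalSpace F] (γ : C(unitInterval, F)) :
    Continuous fun r : ℝ => γ (Set.projIcc 0 1 zero_le_one r) := by
  have : Continuous (Set.projIcc (0 : ℝ) 1 zero_le_one) := continuous_projIcc
  fun_prop

variable {E F : Type u} [NormedAddCommGroup E] [NormedSpace ℝ E]
  [NormedAddCommGroup F] [NormedSpace ℝ F]

/-- Pointwise application of a curve of operators to a curve of vectors. -/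
noncomputable def curveApply (E F : Type u) [NormedAddCommGroup E] [NormedSpace ℝ E]
    [NormedAddCommGroup F] [NormedSpace ℝ F] :
    C(unitInterval, E →L[ℝ] F) →L[ℝ] C(unitInterval, E) →L[ℝ] C(unitInterval, F) :=
  LinearMap.mkContinuous₂
    (LinearMap.mk₂ ℝ
      (fun (L : C(unitInterval, E →L[ℝ] F)) (γ : C(unitInterval, E)) =>
        (⟨fun t => L t (γ t), L.continuous.clm_apply γ.continuous⟩ : C(unitInterval, F)))
      (fun _ _ _ => by ext; simp) (fun _ _ _ => by ext; simp) (fun _ _ _ => by ext; simp)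
      (fun _ _ _ => by ext; simp)) 1 (fun L γ => by
      rw [one_mul, ContinuousMap.norm_le _ (by positivity)]
      intro t
      exact ((L t).le_opNorm _).trans
        (mul_le_mul (L.norm_coe_le_norm t) (γ.norm_coe_le_norm t) (by positivity) (by positivity)))

/-- The superposition operator `γ ↦ f ∘ γ` is differentiable. -/
lemma hasFDerivAt_superposition {f : E → F} (hf : ContDiff ℝ 1 f) (γ : C(unitInterval, E)) :
    HasFDerivAt (fun γ : C(unitInterval, E) => (⟨f, hf.continuous⟩ : C(E, F)).comp γ)
      (curveApply E F ((⟨fderiv ℝ f, hf.continuous_fderiv one_ne_zero⟩ : C(E, E →L[ℝ] F)).comp γ))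
      γ := by
  set f' : C(E, E →L[ℝ] F) := ⟨fderiv ℝ f, hf.continuous_fderiv one_ne_zero⟩
  have hcont : Continuous (fun γ : C(unitInterval, E) => f'.comp γ) :=
    ContinuousMap.continuous_postcomp f'
  rw [hasFDerivAt_iff_isLittleO_nhds_zero, Asymptotics.isLittleO_iff]
  intro ε hε
  obtain ⟨δ, hδ, hball⟩ := Metric.eventually_nhds_iff.1
    ((hcont.tendsto γ).eventually (Metric.ball_mem_nhds (f'.comp γ) hε))
  filter_upwards [Metric.ball_mem_nhds (0 : C(unitInterval, E)) hδ] with h hh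
  rw [mem_ball_zero_iff] at hh
  rw [ContinuousMap.norm_le _ (by positivity)]
  intro t
  have key : ∀ z ∈ segment ℝ (γ t) (γ t + h t), ‖fderiv ℝ f z - fderiv ℝ f (γ t)‖ ≤ ε := by
    intro z hz
    have hz' : ‖z - γ t‖ ≤ ‖h t‖ := by
      have := norm_sub_le_of_mem_segment hz
      simpa using this
    -- The curve `γ` shifted by a constant passes through `z` at time `t` and stays within `δ` of
    -- `γ`. Continuity of `γ ↦ f' ∘ γ` in the sup norm therefore gives an estimate uniform in `t`.
    have h1 : dist (γ + ContinuousMap.const unitInterval (z - γ t)) γ < δ := by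
      rw [dist_eq_norm, add_sub_cancel_left]
      refine lt_of_le_of_lt ?_ hh
      rw [ContinuousMap.norm_le _ (norm_nonneg _)]
      intro s
      exact hz'.trans (h.norm_coe_le_norm t)
    have h2 := (ContinuousMap.dist_apply_le_dist t).trans (hball h1).le
    simpa [f', dist_eq_norm] using h2
  have := (convex_segment (𝕜 := ℝ) (γ t) (γ t + h t)).norm_image_sub_le_of_norm_hasFDerivWithin_le'
    (f := f) (f' := fderiv ℝ f) (φ := fderiv ℝ f (γ t)) (C := ε)
    (fun x _ => ((hf.differentiable one_ne_zero) x).hasFDerivAt.hasFDerivWithinAt) key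
    (left_mem_segment ℝ _ _) (right_mem_segment ℝ _ _)
  simp only [add_sub_cancel_left] at this
  exact this.trans (mul_le_mul_of_nonneg_left (h.norm_coe_le_norm t) hε.le)

/-- The derivative of the superposition operator of `f` is the bounded linear map `curveApply` after
the superposition operator of `fderiv ℝ f`, so one order of smoothness is gained at a time. The
codomain changes to `E →L[ℝ] F` at each step; hence the quantifier over `F` inside the induction and
the common universe. -/
lemma contDiff_superposition_nat (n : ℕ) : ∀ {F : Type u} [NormedAddCommGroup F]
    [NormedSpace ℝ F] {f : E → F} (hf : ContDiff ℝ n f),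
    ContDiff ℝ n (fun γ : C(unitInterval, E) => (⟨f, hf.continuous⟩ : C(E, F)).comp γ) := by
  induction n with
  | zero =>
    intro F _ _ f hf
    exact contDiff_zero.2 (ContinuousMap.continuous_postcomp _)
  | succ n ih =>
    intro F _ _ f hf
    have hf1 : ContDiff ℝ 1 f := hf.of_le (by norm_cast; omega)
    have hf' : ContDiff ℝ n (fderiv ℝ f) := hf.fderiv_right (by norm_cast)
    refine contDiff_succ_iff_hasFDerivAt.2 ⟨_, ?_, fun γ => hasFDerivAt_superposition hf1 γ⟩
    exact (ContinuousLinearMap.contDiff (E := C(unitInterval, E →L[ℝ] F))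
      (F := C(unitInterval, E) →L[ℝ] C(unitInterval, F)) (curveApply E F)).comp (ih hf')

/-- The superposition operator of a smooth function is smooth. -/
lemma contDiff_superposition {f : E → F} (hf : ContDiff ℝ ∞ f) :
    ContDiff ℝ ∞ (fun γ : C(unitInterval, E) => (⟨f, hf.continuous⟩ : C(E, F)).comp γ) :=
  contDiff_infty.2 fun n => contDiff_superposition_nat n (hf.of_le (by exact_mod_cast le_top))

/-- The primitive `s ↦ ∫ r in 0..s, γ r` of a curve. -/
noncomputable def curvePrimitive (F : Type u) [NormedAddCommGroup F] [NormedSpace ℝ F]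
    [CompleteSpace F] : C(unitInterval, F) →L[ℝ] C(unitInterval, F) :=
  LinearMap.mkContinuous
    { toFun := fun γ => ⟨fun s => ∫ r in (0 : ℝ)..s, γ (Set.projIcc 0 1 zero_le_one r),
        (intervalIntegral.continuous_primitive
          (fun a b => (continuous_curveExtend γ).intervalIntegrable a b) 0).comp
            continuous_subtype_val⟩
      map_add' := fun γ δ => by
        ext s
        exact intervalIntegral.integral_add ((continuous_curveExtend γ).intervalIntegrable _ _)
          ((continuous_curveExtend δ).intervalIntegrable _ _)
      map_smul' := fun c γ => by
        ext s
        exact intervalIntegral.integral_smul c _ } 1 (fun γ => by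
      rw [one_mul, ContinuousMap.norm_le _ (by positivity)]
      intro s
      refine (intervalIntegral.norm_integral_le_of_norm_le_const (C := ‖γ‖)
        (fun r _ => γ.norm_coe_le_norm _)).trans ?_
      have h0 : (0 : ℝ) ≤ s := s.2.1
      have h1 : (s : ℝ) ≤ 1 := s.2.2
      rw [sub_zero, abs_of_nonneg h0]
      exact mul_le_of_le_one_right (norm_nonneg _) h1)

lemma curvePrimitive_apply [CompleteSpace F] (γ : C(unitInterval, F)) (s : unitInterval) :
    curvePrimitive F γ s = ∫ r in (0 : ℝ)..s, γ (Set.projIcc 0 1 zero_le_one r) := rfl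

end Superposition

/-! ### Smooth functions near a point -/

section Local

universe u

variable {E F : Type u} [NormedAddCommGroup E] [NormedSpace ℝ E] [FiniteDimensional ℝ E]
  [NormedAddCommGroup F] [NormedSpace ℝ F]

/-- A function which is smooth near a point agrees near this point with a globally smooth one. -/
lemma exists_contDiff_eventuallyEq {f : E → F} {x₀ : E}
    (hf : ∀ᶠ x in 𝓝 x₀, ContDiffAt ℝ ∞ f x) : ∃ g : E → F, ContDiff ℝ ∞ g ∧ g =ᶠ[𝓝 x₀] f := by
  obtain ⟨r, hr, hball⟩ := Metric.nhds_basis_closedBall.mem_iff.1 hf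
  let χ : ContDiffBump x₀ := ⟨r / 2, r, half_pos hr, half_lt_self hr⟩
  refine ⟨fun x => χ x • f x, contDiff_iff_contDiffAt.2 fun x => ?_, ?_⟩
  · by_cases hx : x ∈ tsupport χ
    · rw [χ.tsupport_eq] at hx
      exact χ.contDiffAt.smul (hball hx)
    · have : (fun x => χ x • f x) =ᶠ[𝓝 x] fun _ => 0 := by
        filter_upwards [(isClosed_tsupport χ).isOpen_compl.mem_nhds hx] with y hy
        rw [image_eq_zero_of_notMem_tsupport hy, zero_smul]
      exact contDiffAt_const.congr_of_eventuallyEq this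
  · filter_upwards [χ.eventuallyEq_one] with x hx
    rw [hx, Pi.one_apply, one_smul]

end Local

/-! ### Local diffeomorphisms, division of smooth functions -/

section Division

universe u

/-- The smooth inverse function theorem, on whole neighbourhoods. -/
lemma exists_smooth_openPartialHomeomorph {E F : Type u} [NormedAddCommGroup E] [NormedSpace ℝ E]
    [CompleteSpace E] [NormedAddCommGroup F] [NormedSpace ℝ F] {S : E → F} {a : E}
    (hS : ∀ᶠ x in 𝓝 a, ContDiffAt ℝ ∞ S x) {A : E ≃L[ℝ] F} (hA : HasFDerivAt S (A : E →L[ℝ] F) a)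
    {U : Set E} (hU : U ∈ 𝓝 a) :
    ∃ e : OpenPartialHomeomorph E F, a ∈ e.source ∧ e.source ⊆ U ∧ (∀ x, e x = S x) ∧
      ContDiffOn ℝ ∞ e e.source ∧ ContDiffOn ℝ ∞ e.symm e.target := by
  have hSa : ContDiffAt ℝ ∞ S a := hS.self_of_nhds
  have h0 : (∞ : WithTop ℕ∞) ≠ 0 := by simp
  have hinv : ∀ᶠ x in 𝓝 a, ∃ A' : E ≃L[ℝ] F, (A' : E →L[ℝ] F) = fderiv ℝ S x := by
    have hc : ContinuousAt (fderiv ℝ S) a := hSa.continuousAt_fderiv h0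
    have := A.nhds
    rw [← hA.fderiv] at this
    exact hc this
  -- The inverse is smooth at each point where the differential is invertible, so the source is cut
  -- down to such points. `restr` passes to the interior of `V`.
  set V : Set E := {x | ContDiffAt ℝ ∞ S x ∧ (∃ A' : E ≃L[ℝ] F, (A' : E →L[ℝ] F) = fderiv ℝ S x) ∧
    x ∈ U} with hV
  have hVa : V ∈ 𝓝 a := hS.and (hinv.and hU)
  refine ⟨(hSa.toOpenPartialHomeomorph S hA h0).restr V, ?_, ?_, fun x => rfl, ?_, ?_⟩
  · exact ⟨hSa.mem_toOpenPartialHomeomorph_source hA h0, mem_interior_iff_mem_nhds.2 hVa⟩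
  · exact fun x hx => (interior_subset hx.2).2.2
  · exact fun x hx => (interior_subset hx.2).1.contDiffWithinAt
  · intro y hy
    have hx := OpenPartialHomeomorph.map_target _ hy
    obtain ⟨h1, ⟨A', hA'⟩, -⟩ := interior_subset hx.2
    refine (OpenPartialHomeomorph.contDiffAt_symm _ hy (f₀' := A') ?_ h1).contDiffWithinAt
    rw [hA']
    exact (h1.differentiableAt h0).hasFDerivAt

variable {E F : Type u} [NormedAddCommGroup E] [NormedSpace ℝ E]
  [NormedAddCommGroup F] [NormedSpace ℝ F]

/-- The parametrized line `t ↦ p + t • q`. -/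
noncomputable def lineCurve (E : Type u) [NormedAddCommGroup E] [NormedSpace ℝ E] :
    E × E →L[ℝ] C(unitInterval, E) :=
  LinearMap.mkContinuous
    { toFun := fun p => (⟨fun t => p.1 + (t : ℝ) • p.2, by fun_prop⟩ : C(unitInterval, E))
      map_add' := fun p q => by ext t; simp; abel
      map_smul' := fun c p => by ext t; simp [smul_comm c] } 2 (fun p => by
      rw [ContinuousMap.norm_le _ (by positivity)]
      intro t
      have h0 : (0 : ℝ) ≤ t := t.2.1
      have h1 : (t : ℝ) ≤ 1 := t.2.2
      calc ‖p.1 + (t : ℝ) • p.2‖ ≤ ‖p.1‖ + ‖(t : ℝ) • p.2‖ := norm_add_le _ _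
        _ ≤ ‖p‖ + ‖p‖ := by
            refine add_le_add (norm_fst_le p) ?_
            rw [norm_smul, Real.norm_of_nonneg h0]
            exact (mul_le_of_le_one_left (norm_nonneg _) h1).trans (norm_snd_le p)
        _ = 2 * ‖p‖ := by ring)

@[simp] lemma lineCurve_apply (p : E × E) (t : unitInterval) :
    lineCurve E p t = p.1 + (t : ℝ) • p.2 := rfl

/-- The integral of a smooth function along a segment depends smoothly on the segment. -/
lemma contDiff_integral_segment [CompleteSpace F] {f : E → F} (hf : ContDiff ℝ ∞ f) :
    ContDiff ℝ ∞ fun p : E × E => ∫ t in (0 : ℝ)..1, f (p.1 + t • p.2) := by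
  -- The integral is a composite: segment to curve (linear), superposition with `f` (smooth),
  -- primitive (linear), evaluation at `1` (linear).
  have h1 := (contDiff_superposition hf).comp (lineCurve E).contDiff
  have h2 := (ContinuousLinearMap.contDiff (E := C(unitInterval, F)) (F := C(unitInterval, F))
    (n := ∞) (curvePrimitive F)).comp h1
  have h3 := (ContinuousLinearMap.contDiff (E := C(unitInterval, F)) (n := ∞)
    (ContinuousMap.evalCLM ℝ (1 : unitInterval))).comp h2
  convert h3 using 1
  ext p
  simp only [Function.comp_apply, ContinuousMap.evalCLM_apply, curvePrimitive_apply,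
    Set.Icc.coe_one]
  refine intervalIntegral.integral_congr fun t ht => ?_
  rw [Set.uIcc_of_le zero_le_one] at ht
  simp [Set.projIcc_of_mem zero_le_one ht]

/-- This is Hadamard's form of the mean value theorem. Keeping the operator-valued integral outside
the application to `q` allows a scalar factor of `q` to be pulled out. -/
lemma sub_eq_integral_fderiv_apply [CompleteSpace F] {f : E → F} (hf : ContDiff ℝ ∞ f) (p q : E) :
    f (p + q) - f p = (∫ t in (0 : ℝ)..1, fderiv ℝ f (p + t • q)) q := by
  have hc : Continuous fun t : ℝ => fderiv ℝ f (p + t • q) :=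
    (hf.continuous_fderiv (by simp)).comp (by fun_prop)
  rw [ContinuousLinearMap.intervalIntegral_apply (hc.intervalIntegrable _ _),
    intervalIntegral.integral_eq_sub_of_hasDerivAt (f := fun t : ℝ => f (p + t • q))]
  · simp
  · intro t _
    have h1 : HasDerivAt (fun t : ℝ => p + t • q) q t := by
      simpa using ((hasDerivAt_id t).smul_const q).const_add p
    exact ((hf.differentiable (by simp) _).hasFDerivAt).comp_hasDerivAt t h1
  · exact (hc.clm_apply continuous_const).intervalIntegrable _ _

/-- A smooth function which vanishes on the regular zero set of `g` is a smooth multiple of `g`. -/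
theorem exists_smooth_quotient [FiniteDimensional ℝ E] [CompleteSpace F] {g : E → ℝ} {h : E → F}
    {p₀ : E} (hg : ∀ᶠ p in 𝓝 p₀, ContDiffAt ℝ ∞ g p) (hh : ∀ᶠ p in 𝓝 p₀, ContDiffAt ℝ ∞ h p)
    (hg0 : g p₀ = 0) (hdg : fderiv ℝ g p₀ ≠ 0) (hz : ∀ᶠ p in 𝓝 p₀, g p = 0 → h p = 0) :
    ∃ q : E → F, (∀ᶠ p in 𝓝 p₀, ContDiffAt ℝ ∞ q p) ∧ ∀ᶠ p in 𝓝 p₀, h p = g p • q p := by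
  have : CompleteSpace E := FiniteDimensional.complete ℝ E
  set ℓ := fderiv ℝ g p₀ with hℓ
  obtain ⟨w, hw⟩ : ∃ w, ℓ w = 1 := by
    obtain ⟨w, hw⟩ : ∃ w, ℓ w ≠ 0 := by
      by_contra! hcon
      exact hdg (ContinuousLinearMap.ext hcon)
    exact ⟨(ℓ w)⁻¹ • w, by simp [hw]⟩
  -- Since `ℓ w = 1`, the map satisfies `ℓ (Ψ p - p₀) = g p`, and its differential at `p₀` is the
  -- identity. In the coordinates `Ψ` the function `g` becomes affine.
  set Ψ : E → E := fun p => p + (g p - ℓ (p - p₀)) • w with hΨ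
  have hΨs : ∀ᶠ p in 𝓝 p₀, ContDiffAt ℝ ∞ Ψ p := by
    filter_upwards [hg] with p hp
    fun_prop
  have hΨ0 : Ψ p₀ = p₀ := by simp [hΨ, hg0]
  have hΨd : HasFDerivAt Ψ ((ContinuousLinearEquiv.refl ℝ E : E ≃L[ℝ] E) : E →L[ℝ] E) p₀ := by
    have h1 : HasFDerivAt g ℓ p₀ := (hg.self_of_nhds.differentiableAt (by simp)).hasFDerivAt
    have h2 : HasFDerivAt (fun p => ℓ (p - p₀)) ℓ p₀ := by
      have := ℓ.hasFDerivAt.comp p₀ ((hasFDerivAt_id p₀).sub_const p₀)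
      rwa [ContinuousLinearMap.comp_id] at this
    convert! (hasFDerivAt_id p₀).add ((h1.sub h2).smul_const w) using 1
    ext; simp
  obtain ⟨e, he0, -, heΨ, hes, hesymm⟩ :=
    exists_smooth_openPartialHomeomorph hΨs hΨd Filter.univ_mem
  have hep0 : e p₀ = p₀ := by rw [heΨ, hΨ0]
  have hp0t : p₀ ∈ e.target := by simpa [hep0] using e.map_source he0
  have hesp0 : e.symm p₀ = p₀ := by simpa [hep0] using e.left_inv he0
  have hetend : Filter.Tendsto e (𝓝 p₀) (𝓝 p₀) := by
    simpa [ContinuousAt, hep0] using e.continuousAt he0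
  have hestend : Filter.Tendsto e.symm (𝓝 p₀) (𝓝 p₀) := by
    simpa [ContinuousAt, hesp0] using e.continuousAt_symm hp0t
  have hh' : ∀ᶠ y in 𝓝 p₀, ContDiffAt ℝ ∞ (h ∘ e.symm) y := by
    filter_upwards [hestend.eventually hh, e.open_target.mem_nhds hp0t] with y hy hyt
    exact hy.comp y (hesymm.contDiffAt (e.open_target.mem_nhds hyt))
  obtain ⟨k, hk, hkh⟩ := exists_contDiff_eventuallyEq hh'
  have hkz : ∀ᶠ y in 𝓝 p₀, ℓ (y - p₀) = 0 → k y = 0 := by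
    filter_upwards [hkh, hestend.eventually hz, e.open_target.mem_nhds hp0t] with y hy hyz hyt hl
    rw [hy]
    refine hyz ?_
    have h1 : e (e.symm y) = y := e.right_inv hyt
    rw [heΨ] at h1
    have h2 : ℓ (Ψ (e.symm y) - p₀) = g (e.symm y) := by
      simp only [hΨ, map_sub, map_add, map_smul, hw, smul_eq_mul, mul_one]
      ring
    rw [← h2, h1, hl]
  -- The point `y` is split into its projection along `w` to the hyperplane `ℓ (· - p₀) = 0`, where
  -- `k` vanishes, and a multiple of `w`. Hadamard's formula between the two yields `k y = ℓ (y -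
  -- p₀) • Q y`.
  set pr : E → E × E := fun y => (y - ℓ (y - p₀) • w, ℓ (y - p₀) • w) with hpr
  have hprs : ContDiff ℝ ∞ pr := by fun_prop
  set Q : E → F := fun y => (∫ t in (0 : ℝ)..1, fderiv ℝ k ((pr y).1 + t • (pr y).2)) w with hQ
  have hQs : ContDiff ℝ ∞ Q :=
    ((contDiff_integral_segment (hk.fderiv_right (m := ∞) le_rfl)).comp hprs).clm_apply
      contDiff_const
  have hprt : Filter.Tendsto (fun y => (pr y).1) (𝓝 p₀) (𝓝 p₀) := by
    have : Continuous fun y => (pr y).1 := by fun_prop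
    simpa [hpr] using this.tendsto p₀
  have hkQ : ∀ᶠ y in 𝓝 p₀, k y = ℓ (y - p₀) • Q y := by
    filter_upwards [hprt.eventually hkz] with y hy
    have h1 := sub_eq_integral_fderiv_apply hk (pr y).1 (pr y).2
    rw [hy (by simp [hpr, hw])] at h1
    simp only [hpr, sub_add_cancel, sub_zero, map_smul] at h1
    exact h1
  refine ⟨Q ∘ Ψ, ?_, ?_⟩
  · filter_upwards [hΨs] with p hp
    exact hQs.contDiffAt.comp p hp
  · have hΨt : Filter.Tendsto Ψ (𝓝 p₀) (𝓝 p₀) := by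
      have : (e : E → E) = Ψ := funext heΨ
      rwa [← this]
    filter_upwards [hΨt.eventually hkQ, hΨt.eventually hkh, e.open_source.mem_nhds he0]
      with p h1 h2 h3
    have h4 : e.symm (Ψ p) = p := by rw [← heΨ]; exact e.left_inv h3
    have h5 : ℓ (Ψ p - p₀) = g p := by
      simp only [hΨ, map_sub, map_add, map_smul, hw, smul_eq_mul, mul_one]
      ring
    rw [h2, Function.comp_apply, h4, h5] at h1
    exact h1

/-- If the differential of `g` vanishes along the kernel of a projection `π` at all zeros of `g`
near a regular zero, then up to a nonvanishing smooth factor `g` depends on `π p` only. -/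
theorem exists_factor_of_fderiv_eq_zero_on_ker {E : Type} [NormedAddCommGroup E] [NormedSpace ℝ E]
    [FiniteDimensional ℝ E] {g : E → ℝ} {p₀ : E} {π : E →L[ℝ] E} (hπ : ∀ x, π (π x) = π x)
    (hg : ∀ᶠ p in 𝓝 p₀, ContDiffAt ℝ ∞ g p) (hg0 : g p₀ = 0) (hdg : fderiv ℝ g p₀ ≠ 0)
    (hker : ∀ᶠ p in 𝓝 p₀, g p = 0 → ∀ n, π n = 0 → fderiv ℝ g p n = 0) :
    ∃ F : E → ℝ, (∀ᶠ p in 𝓝 p₀, ContDiffAt ℝ ∞ F p) ∧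
      ∀ᶠ p in 𝓝 p₀, F p ≠ 0 ∧ F p * g p = g (p₀ + π (p - p₀)) := by
  -- `σ` replaces the component of `p` in the kernel of `π` by that of `p₀`.
  set σ : E → E := fun p => p₀ + π (p - p₀) with hσ
  have hσs : ContDiff ℝ ∞ σ := by fun_prop
  have hσ0 : σ p₀ = p₀ := by simp [hσ]
  have hσt : Filter.Tendsto σ (𝓝 p₀) (𝓝 p₀) := by
    simpa [hσ0] using hσs.continuous.tendsto p₀
  -- the differential along the kernel is a multiple of `g`
  obtain ⟨q, hq, hgq⟩ := exists_smooth_quotient (E := E) (F := E →L[ℝ] ℝ) (g := g)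
    (h := fun p => (fderiv ℝ g p).comp (ContinuousLinearMap.id ℝ E - π)) hg
    (by
      filter_upwards [hg] with p hp
      exact (hp.fderiv_right (m := ∞) le_rfl).clm_comp contDiffAt_const)
    hg0 hdg
    (by
      filter_upwards [hker] with p hp h0
      ext n
      exact hp h0 _ (by simp [hπ]))
  have hqb : ∀ᶠ p in 𝓝 p₀, ‖q p‖ < ‖q p₀‖ + 1 :=
    hq.self_of_nhds.continuousAt.norm.eventually_lt_const (lt_add_one _)
  obtain ⟨r, hr, hball⟩ := Metric.eventually_nhds_iff_ball.1 (hg.and (hgq.and hqb))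
  -- zeros of `g` are mapped to zeros by `σ`
  have hzero : ∀ᶠ p in 𝓝 p₀, g p = 0 → g (σ p) = 0 := by
    filter_upwards [Metric.ball_mem_nhds p₀ hr, hσt.eventually (Metric.ball_mem_nhds p₀ hr)]
      with p hp hσp h0
    set n := σ p - p with hn
    have hπn : π n = 0 := by
      have : n = π (p - p₀) - (p - p₀) := by simp only [hn, hσ]; abel
      rw [this, map_sub, hπ, sub_self]
    have hmem : ∀ t ∈ Set.Icc (0 : ℝ) 1, p + t • n ∈ Metric.ball p₀ r := fun t ht =>
      (convex_ball p₀ r).add_smul_sub_mem hp hσp ht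
    have hder : ∀ t ∈ Set.Icc (0 : ℝ) 1,
        HasDerivAt (fun t : ℝ => g (p + t • n)) (fderiv ℝ g (p + t • n) n) t := by
      intro t ht
      have h1 : HasDerivAt (fun t : ℝ => p + t • n) n t := by
        simpa using ((hasDerivAt_id t).smul_const n).const_add p
      exact ((hball _ (hmem t ht)).1.differentiableAt (by simp)).hasFDerivAt.comp_hasDerivAt t h1
    -- Along the segment from `p` to `σ p` the direction `n` lies in the kernel, so the derivative
    -- of `g` is `g` times a bounded factor. Starting from the value `0`, it stays `0`.
    have hG := norm_le_gronwallBound_of_norm_deriv_right_le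
      (f := fun t : ℝ => g (p + t • n)) (f' := fun t => fderiv ℝ g (p + t • n) n) (δ := 0)
      (K := (‖q p₀‖ + 1) * ‖n‖) (ε := 0) (a := 0) (b := 1)
      (fun t ht => (hder t ht).continuousAt.continuousWithinAt)
      (fun t ht => (hder t (Set.Ico_subset_Icc_self ht)).hasDerivWithinAt) (by simp [h0])
      (fun t ht => by
        obtain ⟨-, h2, h3⟩ := hball _ (hmem t (Set.Ico_subset_Icc_self ht))
        have h4 := DFunLike.congr_fun h2 n
        simp only [ContinuousLinearMap.comp_apply, sub_apply,
          ContinuousLinearMap.id_apply, hπn, sub_zero, smul_apply] at h4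
        rw [h4, norm_smul, add_zero, mul_comm]
        refine mul_le_mul_of_nonneg_right ?_ (norm_nonneg _)
        exact ((q _).le_opNorm n).trans (mul_le_mul_of_nonneg_right h3.le (norm_nonneg _)))
      1 (Set.right_mem_Icc.2 zero_le_one)
    simpa [gronwallBound_ε0_δ0, hn] using hG
  obtain ⟨F, hF, hgF⟩ := exists_smooth_quotient (E := E) (F := ℝ) (g := g) (h := fun p => g (σ p))
    hg (by
      filter_upwards [hσt.eventually hg] with p hp
      exact hp.comp p hσs.contDiffAt) hg0 hdg hzero
  -- If `F p₀ = 0`, then `F g` has zero differential at `p₀`, because `g p₀ = 0` as well. The same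
  -- differential is that of `g ∘ σ`, namely `dg ∘ π`, which equals `dg` since `dg` vanishes on the
  -- kernel. This contradicts `dg ≠ 0`.
  have hF0 : F p₀ ≠ 0 := by
    intro hcon
    have h1 : HasFDerivAt g (fderiv ℝ g p₀) p₀ :=
      (hg.self_of_nhds.differentiableAt (by simp)).hasFDerivAt
    have h2 : HasFDerivAt F (fderiv ℝ F p₀) p₀ :=
      (hF.self_of_nhds.differentiableAt (by simp)).hasFDerivAt
    have h3 : HasFDerivAt σ π p₀ := by
      have := (π.hasFDerivAt.comp p₀ ((hasFDerivAt_id p₀).sub_const p₀)).const_add p₀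
      rwa [ContinuousLinearMap.comp_id] at this
    have h4 : HasFDerivAt (fun p => g (σ p)) ((fderiv ℝ g p₀).comp π) p₀ :=
      HasFDerivAt.comp p₀ (by rwa [hσ0]) h3
    have h5 : HasFDerivAt (fun p => g (σ p)) (0 : E →L[ℝ] ℝ) p₀ := by
      have h6 := (h1.mul h2).congr_of_eventuallyEq
        (f₁ := fun p => g (σ p)) (by filter_upwards [hgF] with p hp; simpa using hp)
      simpa [hcon, hg0] using h6
    refine hdg (ContinuousLinearMap.ext fun x => ?_)
    have h7 := DFunLike.congr_fun (h4.unique h5) x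
    have h8 := hker.self_of_nhds hg0 (x - π x) (by simp [hπ])
    rw [map_sub, sub_eq_zero] at h8
    rw [h8]
    exact h7
  refine ⟨F, hF, ?_⟩
  filter_upwards [hF.self_of_nhds.continuousAt.eventually_ne hF0, hgF] with p h1 h2
  exact ⟨h1, by rw [h2, smul_eq_mul, mul_comm]⟩

end Division

/-! ### Smooth flows -/

section Flow

variable {E : Type} [NormedAddCommGroup E] [NormedSpace ℝ E] [CompleteSpace E]

/-- The curves `γ : [0, 1] → E` with `γ s = x + τ ∫_0^s f(γ)` depend smoothly on `(τ, x)` and are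
unique near the constant curve. -/
lemma exists_smooth_integral_curves {f : E → E} (hf : ContDiff ℝ ∞ f) (x₀ : E) :
    ∃ Γ : ℝ × E → C(unitInterval, E),
      (∀ᶠ p in 𝓝 ((0 : ℝ), x₀), ContDiffAt ℝ ∞ Γ p) ∧ Γ (0, x₀) = ContinuousMap.const _ x₀ ∧
      (∀ᶠ p in 𝓝 ((0 : ℝ), x₀), ∀ s : unitInterval,
        Γ p s = p.2 + p.1 • ∫ r in (0 : ℝ)..s, f (Γ p (Set.projIcc 0 1 zero_le_one r))) ∧
      ∃ ε > 0, ∀ p : ℝ × E, ∀ γ : C(unitInterval, E), dist p (0, x₀) < ε →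
        dist γ (ContinuousMap.const _ x₀) < ε →
        (∀ s : unitInterval,
          γ s = p.2 + p.1 • ∫ r in (0 : ℝ)..s, f (γ (Set.projIcc 0 1 zero_le_one r))) →
        γ = Γ p := by
  let fC : C(E, E) := ⟨f, hf.continuous⟩
  let c : E →L[ℝ] C(unitInterval, E) := (lineCurve E).comp (ContinuousLinearMap.inl ℝ E E)
  have hc : ∀ x s, c x s = x := fun x s => by
    change x + (s : ℝ) • (0 : E) = x
    simp
  have hcc : ∀ x, c x = ContinuousMap.const _ x := fun x => ContinuousMap.ext fun s => hc x s
  let N : C(unitInterval, E) → C(unitInterval, E) := fun γ => curvePrimitive E (fC.comp γ)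
  have hN : ContDiff ℝ ∞ N :=
    (ContinuousLinearMap.contDiff (E := C(unitInterval, E)) (F := C(unitInterval, E)) (curvePrimitive E)).comp
      (contDiff_superposition hf)
  let Ψ : (ℝ × E) × C(unitInterval, E) → (ℝ × E) × C(unitInterval, E) := fun p => (p.1, p.2 - c p.1.2 - p.1.1 • N p.2)
  have hΨ : ContDiff ℝ ∞ Ψ := by
    have h1 : ContDiff ℝ ∞ fun p : (ℝ × E) × C(unitInterval, E) => N p.2 := hN.comp contDiff_snd
    have h2 : ContDiff ℝ ∞ fun p : (ℝ × E) × C(unitInterval, E) => c p.1.2 := c.contDiff.comp (by fun_prop)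
    exact contDiff_fst.prodMk
      ((contDiff_snd.sub h2).sub ((contDiff_fst.comp contDiff_fst).smul h1))
  let L : (ℝ × E) →L[ℝ] C(unitInterval, E) :=
    c.comp (ContinuousLinearMap.snd ℝ ℝ E) +
      (ContinuousLinearMap.fst ℝ ℝ E).smulRight (N (c x₀))
  -- At `τ = 0` the derivative of `N` drops out, so the differential of `Ψ` is `(p, γ) ↦ (p, γ - L
  -- p)`. Its inverse is obtained by changing the sign of `L`.
  let A : ((ℝ × E) × C(unitInterval, E)) ≃L[ℝ] ((ℝ × E) × C(unitInterval, E)) := ContinuousLinearEquiv.equivOfInverse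
    ((ContinuousLinearMap.fst ℝ (ℝ × E) C(unitInterval, E)).prod
      (ContinuousLinearMap.snd ℝ (ℝ × E) C(unitInterval, E) - L.comp (ContinuousLinearMap.fst ℝ (ℝ × E) C(unitInterval, E))))
    ((ContinuousLinearMap.fst ℝ (ℝ × E) C(unitInterval, E)).prod
      (ContinuousLinearMap.snd ℝ (ℝ × E) C(unitInterval, E) + L.comp (ContinuousLinearMap.fst ℝ (ℝ × E) C(unitInterval, E))))
    (fun p => by simp) (fun p => by simp)
  let u : (ℝ × E) × C(unitInterval, E) := ((0, x₀), c x₀)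
  have hA : HasFDerivAt Ψ (A : ((ℝ × E) × C(unitInterval, E)) →L[ℝ] ((ℝ × E) × C(unitInterval, E))) u := by
    have h1 : HasFDerivAt N (fderiv ℝ N u.2) u.2 :=
      (hN.differentiable (by simp) _).hasFDerivAt
    have h2 : HasFDerivAt (fun p : (ℝ × E) × C(unitInterval, E) => N p.2) _ u :=
      h1.comp u hasFDerivAt_snd
    have h3 : HasFDerivAt (fun p : (ℝ × E) × C(unitInterval, E) => c p.1.2) _ u :=
      c.hasFDerivAt.comp u (hasFDerivAt_snd.comp u hasFDerivAt_fst)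
    have h4 : HasFDerivAt (fun p : (ℝ × E) × C(unitInterval, E) => p.1.1)
        ((ContinuousLinearMap.fst ℝ ℝ E).comp
          (ContinuousLinearMap.fst ℝ (ℝ × E) C(unitInterval, E))) u :=
      ((ContinuousLinearMap.fst ℝ ℝ E).comp
        (ContinuousLinearMap.fst ℝ (ℝ × E) C(unitInterval, E))).hasFDerivAt
    have h5 := (hasFDerivAt_fst (p := u)).prodMk ((hasFDerivAt_snd.sub h3).sub (h4.smul h2))
    convert! h5 using 1
    refine ContinuousLinearMap.ext fun p => ?_
    simp [A, L, u, sub_sub]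
  obtain ⟨e, heu, -, heΨ, -, hesymm⟩ :=
    exists_smooth_openPartialHomeomorph (Filter.Eventually.of_forall fun p => hΨ.contDiffAt) hA
      Filter.univ_mem
  have hΨu : Ψ u = ((0, x₀), 0) := by simp [Ψ, u]
  have hut : ((0, x₀), 0) ∈ e.target := by
    rw [← hΨu, ← heΨ]; exact e.map_source heu
  have hinj : Continuous fun p : ℝ × E => (p, (0 : C(unitInterval, E))) := by fun_prop
  have hev : ∀ᶠ p in 𝓝 ((0 : ℝ), x₀), (p, (0 : C(unitInterval, E))) ∈ e.target :=
    hinj.continuousAt.eventually (e.open_target.mem_nhds hut)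
  have hiff : ∀ (p : ℝ × E) (γ : C(unitInterval, E)), Ψ (p, γ) = (p, 0) ↔ ∀ s : unitInterval,
      γ s = p.2 + p.1 • ∫ r in (0 : ℝ)..s, f (γ (Set.projIcc 0 1 zero_le_one r)) := by
    intro p γ
    simp only [Ψ, Prod.mk.injEq, true_and]
    rw [ContinuousMap.ext_iff]
    refine forall_congr' fun s => ?_
    change γ s - c p.2 s - p.1 • (∫ r in (0 : ℝ)..s, f (γ (Set.projIcc 0 1 zero_le_one r))) = 0 ↔ _
    rw [hc, sub_sub, sub_eq_zero]
  refine ⟨fun p => (e.symm (p, 0)).2, ?_, ?_, ?_, ?_⟩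
  · filter_upwards [hev] with p hp
    have h1 : ContDiffAt ℝ ∞ e.symm (p, (0 : C(unitInterval, E))) := hesymm.contDiffAt (e.open_target.mem_nhds hp)
    exact contDiffAt_snd.comp p (h1.comp p (contDiffAt_id.prodMk contDiffAt_const))
  · have : e.symm ((0, x₀), 0) = u := by
      rw [← hΨu, ← heΨ]; exact e.left_inv heu
    simp only [this, u, hcc]
  · filter_upwards [hev] with p hp
    have h1 : Ψ (e.symm (p, 0)) = (p, 0) := by rw [← heΨ]; exact e.right_inv hp
    have h2 : (e.symm (p, 0)).1 = p := congrArg Prod.fst h1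
    refine (hiff p _).1 ?_
    convert! h1
    exact h2.symm
  · obtain ⟨ε, hε, hball⟩ := Metric.mem_nhds_iff.1 (e.open_source.mem_nhds heu)
    refine ⟨ε, hε, fun p γ hp hγ h => ?_⟩
    have h1 : (p, γ) ∈ e.source := by
      refine hball ?_
      rw [Metric.mem_ball, Prod.dist_eq]
      exact max_lt hp (by simpa only [u, hcc] using hγ)
    have h2 := e.left_inv h1
    rw [heΨ, (hiff p γ).2 h] at h2
    exact (congrArg Prod.snd h2).symm

/-- The local flow of a smooth vector field is smooth. -/
theorem exists_smooth_flow {f : E → E} (hf : ContDiff ℝ ∞ f) (x₀ : E) :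
    ∃ Φ : ℝ × E → E, (∀ᶠ p in 𝓝 ((0 : ℝ), x₀), ContDiffAt ℝ ∞ Φ p) ∧
      (∀ᶠ p in 𝓝 ((0 : ℝ), x₀), HasDerivAt (fun t => Φ (t, p.2)) (f (Φ p)) p.1) ∧
      ∀ᶠ x in 𝓝 x₀, Φ (0, x) = x := by
  obtain ⟨Γ, hΓs, hΓ0, hΓ, ε, hε, huniq⟩ := exists_smooth_integral_curves hf x₀
  have hΦs : ∀ᶠ p in 𝓝 ((0 : ℝ), x₀), ContDiffAt ℝ ∞ (fun p => Γ p 1) p := by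
    filter_upwards [hΓs] with p hp
    exact (ContinuousLinearMap.contDiff (E := C(unitInterval, E))
      (ContinuousMap.evalCLM ℝ (1 : unitInterval))).contDiffAt.comp p hp
  have hclose : ∀ᶠ p in 𝓝 ((0 : ℝ), x₀), dist (Γ p) (ContinuousMap.const _ x₀) < ε := by
    rw [← hΓ0]
    exact hΓs.self_of_nhds.continuousAt.eventually (Metric.ball_mem_nhds _ hε)
  obtain ⟨δ, hδ, hball⟩ := Metric.eventually_nhds_iff_ball.1
    (hΓ.and (hΦs.and (hclose.and (Metric.ball_mem_nhds _ hε))))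
  -- the curves are reparametrizations of each other
  have hscale : ∀ p ∈ Metric.ball ((0 : ℝ), x₀) δ, ∀ s : unitInterval,
      Γ ((s : ℝ) * p.1, p.2) 1 = Γ p s := by
    intro p hp s
    obtain ⟨h1, -, h3, h4⟩ := hball p hp
    -- Rescaling time by `s` turns a solution for the parameter `τ` into one for `s τ`. Local
    -- uniqueness identifies it with the chosen solution.
    let γ : C(unitInterval, E) := ⟨fun r => Γ p (s * r), by fun_prop⟩
    have hγ : γ = Γ ((s : ℝ) * p.1, p.2) := by
      refine huniq _ _ ?_ ?_ ?_
      · refine lt_of_le_of_lt ?_ h4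
        simp only [Prod.dist_eq]
        refine max_le_max ?_ le_rfl
        rw [dist_zero_right, dist_zero_right, norm_mul]
        refine mul_le_of_le_one_left (norm_nonneg _) ?_
        rw [Real.norm_of_nonneg s.2.1]
        exact s.2.2
      · refine lt_of_le_of_lt ?_ h3
        rw [ContinuousMap.dist_le dist_nonneg]
        intro r
        exact ContinuousMap.dist_apply_le_dist (f := Γ p) (g := ContinuousMap.const _ x₀) (s * r)
      · intro r
        have h5 := h1 (s * r)
        change Γ p (s * r) = _
        rw [h5, Set.Icc.coe_mul, mul_comm (s : ℝ) p.1, mul_smul]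
        congr 2
        have h6 := intervalIntegral.smul_integral_comp_mul_left (a := (0 : ℝ)) (b := (r : ℝ))
          (fun y => f (Γ p (Set.projIcc 0 1 zero_le_one y))) (s : ℝ)
        rw [mul_zero] at h6
        rw [← h6]
        congr 1
        refine intervalIntegral.integral_congr fun y hy => ?_
        rw [Set.uIcc_of_le r.2.1] at hy
        have hy1 : y ∈ Set.Icc (0 : ℝ) 1 := ⟨hy.1, hy.2.trans r.2.2⟩
        have hy2 : (s : ℝ) * y ∈ Set.Icc (0 : ℝ) 1 :=
          ⟨mul_nonneg s.2.1 hy1.1, mul_le_one₀ s.2.2 hy1.1 hy1.2⟩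
        simp only [γ, ContinuousMap.coe_mk, Set.projIcc_of_mem zero_le_one hy1,
          Set.projIcc_of_mem zero_le_one hy2]
        rfl
    rw [← hγ]
    simp [γ]
  -- The function `r ↦ Γ (r τ, x) 1 = Γ (τ, x) r` is differentiated at `s` twice: by the chain rule,
  -- and through the integral equation. Cancelling `τ ≠ 0` gives the differential equation at time
  -- `s τ`.
  have hder : ∀ p ∈ Metric.ball ((0 : ℝ), x₀) δ, p.1 ≠ 0 → ∀ s : unitInterval,
      HasDerivAt (fun t => Γ (t, p.2) 1) (f (Γ ((s : ℝ) * p.1, p.2) 1)) ((s : ℝ) * p.1) := by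
    intro p hp hp0 s
    have hmem : ((s : ℝ) * p.1, p.2) ∈ Metric.ball ((0 : ℝ), x₀) δ := by
      rw [Metric.mem_ball] at hp ⊢
      refine lt_of_le_of_lt ?_ hp
      simp only [Prod.dist_eq]
      refine max_le_max ?_ le_rfl
      rw [dist_zero_right, dist_zero_right, norm_mul]
      refine mul_le_of_le_one_left (norm_nonneg _) ?_
      rw [Real.norm_of_nonneg s.2.1]
      exact s.2.2
    have h1 : DifferentiableAt ℝ (fun t => Γ (t, p.2) 1) ((s : ℝ) * p.1) := by
      have h2 := (hball _ hmem).2.1.differentiableAt (by simp)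
      exact h2.comp ((s : ℝ) * p.1) (f := fun t : ℝ => (t, p.2)) (by fun_prop)
    have h3 : HasDerivWithinAt (fun r : ℝ => Γ (r * p.1, p.2) 1)
        (p.1 • deriv (fun t => Γ (t, p.2) 1) ((s : ℝ) * p.1)) (Set.Icc 0 1) s :=
      (HasDerivAt.scomp (g₁ := fun t => Γ (t, p.2) 1) (h := fun r => r * p.1) (s : ℝ)
        h1.hasDerivAt (by simpa using (hasDerivAt_id (s : ℝ)).mul_const p.1)).hasDerivWithinAt
    have hcont : Continuous fun r : ℝ => f (Γ p (Set.projIcc 0 1 zero_le_one r)) :=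
      hf.continuous.comp (continuous_curveExtend (Γ p))
    have h4 : HasDerivWithinAt (fun r : ℝ => Γ (r * p.1, p.2) 1)
        (p.1 • f (Γ ((s : ℝ) * p.1, p.2) 1)) (Set.Icc 0 1) s := by
      have h5 : HasDerivAt (fun r : ℝ => p.2 + p.1 • ∫ y in (0 : ℝ)..r,
          f (Γ p (Set.projIcc 0 1 zero_le_one y)))
          (p.1 • f (Γ p (Set.projIcc 0 1 zero_le_one s))) s :=
        ((hcont.integral_hasStrictDerivAt 0 (s : ℝ)).hasDerivAt.const_smul p.1).const_add p.2
      rw [Set.projIcc_val, ← hscale p hp s] at h5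
      refine h5.hasDerivWithinAt.congr_of_mem (fun r hr => ?_) s.2
      have h6 := hscale p hp ⟨r, hr⟩
      rw [(hball p hp).1] at h6
      exact h6
    have h7 := (uniqueDiffOn_Icc zero_lt_one (s : ℝ) s.2).eq_deriv _ h3 h4
    have h8 := smul_right_injective E hp0 h7
    rw [← h8]
    exact h1.hasDerivAt
  refine ⟨fun p => Γ p 1, hΦs, ?_, ?_⟩
  · filter_upwards [Metric.ball_mem_nhds ((0 : ℝ), x₀) hδ] with p hp
    by_cases hp0 : p.1 = 0
    -- Time `0` is reached from the nonzero time `δ / 2` by taking `s = 0`.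
    · have hp' : (δ / 2, p.2) ∈ Metric.ball ((0 : ℝ), x₀) δ := by
        rw [Metric.mem_ball, Prod.dist_eq, max_lt_iff] at hp ⊢
        refine ⟨?_, hp.2⟩
        rw [dist_zero_right, Real.norm_of_nonneg (half_pos hδ).le]
        exact half_lt_self hδ
      have := hder _ hp' (half_pos hδ).ne' 0
      simp only [Set.Icc.coe_zero, zero_mul] at this
      rw [← hp0] at this
      exact this
    · simpa using hder p hp hp0 1
  · have : Continuous fun x : E => ((0 : ℝ), x) := by fun_prop
    filter_upwards [this.continuousAt.eventually hΓ] with x hx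
    simpa using hx 1

end Flow

/-! ### Rectification of a vector field by its flow -/

section FlowBox

variable {E : Type} [NormedAddCommGroup E] [NormedSpace ℝ E] [FiniteDimensional ℝ E]

/-- A smooth vector field is rectified by a local diffeomorphism with prescribed differential. -/
theorem exists_flow_box {v : E → E} {b₀ : E} (hv : ∀ᶠ b in 𝓝 b₀, ContDiffAt ℝ ∞ v b)
    {ℓ : E →L[ℝ] ℝ} {e : E} (hℓ : ℓ e = 1) {M : E ≃L[ℝ] E} (hM : M e = v b₀) {B : Set E}
    (hB : B ∈ 𝓝 b₀) :
    ∃ S : OpenPartialHomeomorph E E, 0 ∈ S.source ∧ S 0 = b₀ ∧ S.target ⊆ B ∧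
      ContDiffOn ℝ ∞ S S.source ∧ ContDiffOn ℝ ∞ S.symm S.target ∧
      HasFDerivAt S (M : E →L[ℝ] E) 0 ∧ ∀ y ∈ S.source, fderiv ℝ S y e = v (S y) := by
  have : CompleteSpace E := FiniteDimensional.complete ℝ E
  obtain ⟨f, hf, hfv⟩ := exists_contDiff_eventuallyEq hv
  obtain ⟨Φ, hΦs, hΦd, hΦ0⟩ := exists_smooth_flow hf b₀
  -- The candidate is `Φ ∘ α`: the component of `y` in `ker ℓ` is placed in the transversal `b₀ + M
  -- (ker ℓ)` and then flows for time `ℓ y`. Moving `y` along `e` changes only the time, so `e` is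
  -- carried to the field.
  set α : E → ℝ × E := fun y => (ℓ y, b₀ + M (y - ℓ y • e)) with hα
  have hαs : ContDiff ℝ ∞ α := by fun_prop
  have hα0 : α 0 = (0, b₀) := by simp [hα]
  have hαt : Filter.Tendsto α (𝓝 0) (𝓝 (0, b₀)) := by
    simpa [hα0] using hαs.continuous.tendsto 0
  have hαe : ∀ (y : E) (t : ℝ), α (y + t • e) = ((α y).1 + t, (α y).2) := by
    intro y t
    simp only [hα, map_add, map_smul, hℓ, smul_eq_mul, mul_one, Prod.mk.injEq, true_and]
    congr 2
    rw [add_smul]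
    abel
  have hS0 : Φ (α 0) = b₀ := by rw [hα0]; exact hΦ0.self_of_nhds
  have hSs : ∀ᶠ y in 𝓝 (0 : E), ContDiffAt ℝ ∞ (Φ ∘ α) y := by
    filter_upwards [hαt.eventually hΦs] with y hy
    exact hy.comp y hαs.contDiffAt
  have hSt : Filter.Tendsto (Φ ∘ α) (𝓝 0) (𝓝 b₀) := by
    have := hSs.self_of_nhds.continuousAt
    rwa [ContinuousAt, Function.comp_apply, hS0] at this
  have hSd : HasFDerivAt (Φ ∘ α) (M : E →L[ℝ] E) 0 := by
    have h1 : HasFDerivAt Φ (fderiv ℝ Φ (0, b₀)) (0, b₀) :=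
      (hΦs.self_of_nhds.differentiableAt (by simp)).hasFDerivAt
    have h2 : ∀ s : ℝ, fderiv ℝ Φ (0, b₀) (s, 0) = s • v b₀ := by
      intro s
      have h3 : HasDerivAt (fun t : ℝ => (t, b₀)) ((1 : ℝ), (0 : E)) 0 :=
        (hasDerivAt_id (0 : ℝ)).prodMk (hasDerivAt_const _ _)
      have h4 := (HasFDerivAt.comp_hasDerivAt (0 : ℝ) h1 h3).unique hΦd.self_of_nhds
      have h5 : ((s, 0) : ℝ × E) = s • ((1 : ℝ), (0 : E)) := by simp
      have h6 : Φ (0, b₀) = b₀ := hΦ0.self_of_nhds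
      rw [h5, map_smul, h4, h6, hfv.self_of_nhds]
    have h7 : ∀ x : E, fderiv ℝ Φ (0, b₀) (0, x) = x := by
      intro x
      have h8 : HasFDerivAt (fun x : E => ((0 : ℝ), x)) (ContinuousLinearMap.inr ℝ ℝ E) b₀ :=
        hasFDerivAt_prodMk_right 0 b₀
      have h9 := (HasFDerivAt.comp b₀ h1 h8).unique
        ((hasFDerivAt_id b₀).congr_of_eventuallyEq hΦ0)
      exact DFunLike.congr_fun h9 x
    have h10 : HasFDerivAt α (ℓ.prod ((M : E →L[ℝ] E).comp
        (ContinuousLinearMap.id ℝ E - ℓ.smulRight e))) 0 := by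
      have h11 : HasFDerivAt (fun y => y - ℓ y • e)
          (ContinuousLinearMap.id ℝ E - ℓ.smulRight e) 0 :=
        (ContinuousLinearMap.id ℝ E - ℓ.smulRight e).hasFDerivAt
      exact ℓ.hasFDerivAt.prodMk (((M : E →L[ℝ] E).hasFDerivAt.comp 0 h11).const_add b₀)
    rw [← hα0] at h1
    convert! h1.comp 0 h10 using 1
    ext y
    have h12 : ((ℓ y, M (y - ℓ y • e)) : ℝ × E) = (ℓ y, 0) + (0, M (y - ℓ y • e)) := by simp
    change M y = fderiv ℝ Φ (α 0) (ℓ y, M (y - ℓ y • e))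
    rw [hα0, h12, map_add, h2, h7, map_sub, map_smul, hM]
    abel
  have hU : {y | Φ (α y) ∈ B ∧ fderiv ℝ (Φ ∘ α) y e = v (Φ (α y))} ∈ 𝓝 (0 : E) := by
    filter_upwards [hSt.eventually hB, hSt.eventually hfv, hαt.eventually hΦd, hSs]
      with y h1 h2 h3 h4
    refine ⟨h1, ?_⟩
    change fderiv ℝ (Φ ∘ α) y e = v ((Φ ∘ α) y)
    rw [← h2]
    have h5 : HasDerivAt (fun t : ℝ => y + t • e) e 0 := by
      simpa using ((hasDerivAt_id (0 : ℝ)).smul_const e).const_add y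
    have h6 : HasDerivAt (fun t : ℝ => (Φ ∘ α) (y + t • e)) (fderiv ℝ (Φ ∘ α) y e) 0 :=
      HasFDerivAt.comp_hasDerivAt (0 : ℝ)
        (by simpa using (h4.differentiableAt (by simp)).hasFDerivAt) h5
    have h7 : HasDerivAt (fun t : ℝ => Φ ((α y).1 + t, (α y).2)) (f (Φ (α y))) 0 :=
      HasDerivAt.comp_const_add (α y).1 0 (by simpa using h3)
    have h8 : (fun t : ℝ => (Φ ∘ α) (y + t • e)) = fun t : ℝ => Φ ((α y).1 + t, (α y).2) :=
      funext fun t => by rw [Function.comp_apply, hαe]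
    rw [h8] at h6
    exact h6.unique h7
  obtain ⟨S, h0, hSU, hS, h1, h2⟩ := exists_smooth_openPartialHomeomorph hSs hSd hU
  have hS' : (S : E → E) = Φ ∘ α := funext hS
  refine ⟨S, h0, by rw [hS, Function.comp_apply, hS0], ?_, h1, h2, by rwa [hS'], ?_⟩
  · intro x hx
    have := (hSU (S.map_target hx)).1
    rwa [← Function.comp_apply (f := Φ), ← hS, S.right_inv hx] at this
  · intro y hy
    rw [hS']
    exact (hSU hy).2

end FlowBox

/-! ### Smooth functions on the jet space of infinite order -/

section JetCalculus

variable {m : ℕ}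

namespace JetSpace

/-- Truncation as a linear map. -/
def truncL (m k : ℕ) : JetSpace m →ₗ[ℝ] Jet m k where
  toFun := trunc k
  map_add' _ _ := rfl
  map_smul' _ _ := rfl

lemma continuous_trunc (k : ℕ) : Continuous (trunc (m := m) k) := by
  unfold trunc
  fun_prop

lemma trunc_add (k : ℕ) (z w : JetSpace m) : (z + w).trunc k = z.trunc k + w.trunc k := rfl

lemma trunc_smul (k : ℕ) (c : ℝ) (z : JetSpace m) : (c • z).trunc k = c • z.trunc k := rfl

/-- The projection between jet spaces of finite order. -/
def restrict {k l : ℕ} (h : k ≤ l) : Jet m l →ₗ[ℝ] Jet m k where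
  toFun p := (p.1, fun a J => p.2 a ⟨J.1, J.2.trans h⟩)
  map_add' _ _ := rfl
  map_smul' _ _ := rfl

lemma contDiff_restrict {k l : ℕ} (h : k ≤ l) : ContDiff ℝ ∞ (restrict (m := m) h) :=
  (LinearMap.toContinuousLinearMap (restrict (m := m) h)).contDiff

lemma tendsto_restrict {k l : ℕ} (h : k ≤ l) (z : JetSpace m) :
    Filter.Tendsto (restrict h) (𝓝 (z.trunc l)) (𝓝 (z.trunc k)) :=
  (contDiff_restrict h).continuous.tendsto (z.trunc l)

/-- The product topology is the initial topology of the truncations, since each coordinate already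
occurs in some finite order. -/
lemma nhds_eq_iInf (z₀ : JetSpace m) :
    𝓝 z₀ = ⨅ k, Filter.comap (trunc k) (𝓝 (z₀.trunc k)) := by
  refine le_antisymm (le_iInf fun k => ((continuous_trunc k).tendsto z₀).le_comap) ?_
  have hx : Filter.Tendsto (fun z : JetSpace m => z.1)
      (⨅ k, Filter.comap (trunc k) (𝓝 (z₀.trunc k))) (𝓝 z₀.1) :=
    Filter.Tendsto.mono_left (((continuous_fst.tendsto (z₀.trunc 0))).comp Filter.tendsto_comap)
      (iInf_le _ 0)
  have hu : Filter.Tendsto (fun z : JetSpace m => z.2)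
      (⨅ k, Filter.comap (trunc k) (𝓝 (z₀.trunc k))) (𝓝 z₀.2) := by
    refine tendsto_pi_nhds.2 fun a => tendsto_pi_nhds.2 fun J => ?_
    have h1 : Continuous fun p : Jet m (∑ i, J i) => p.2 a ⟨J, le_rfl⟩ := by fun_prop
    exact Filter.Tendsto.mono_left ((h1.tendsto (z₀.trunc _)).comp Filter.tendsto_comap)
      (iInf_le _ (∑ i, J i))
  exact hx.prodMk_nhds hu

/-- The pulled-back filters decrease as the order grows, so the infimum is directed and a
neighbourhood is already controlled by a single finite order. -/
lemma exists_trunc_of_mem_nhds {z₀ : JetSpace m} {s : Set (JetSpace m)} (hs : s ∈ 𝓝 z₀) :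
    ∃ k, ∃ U ∈ 𝓝 (z₀.trunc k), ∀ z : JetSpace m, z.trunc k ∈ U → z ∈ s := by
  rw [nhds_eq_iInf, Filter.mem_iInf_of_directed] at hs
  · obtain ⟨k, U, hU, hUs⟩ := hs
    exact ⟨k, U, hU, fun z hz => hUs hz⟩
  · refine directed_of_isDirected_le fun k l hkl => ?_
    change Filter.comap (trunc l) _ ≤ Filter.comap (restrict hkl ∘ trunc l) _
    rw [← Filter.comap_comap]
    exact Filter.comap_mono (tendsto_restrict hkl z₀).le_comap

end JetSpace

open JetSpace

variable {E F : Type*} [NormedAddCommGroup E] [NormedSpace ℝ E]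
  [NormedAddCommGroup F] [NormedSpace ℝ F]

/-- Vector valued smooth differential functions near a jet. -/
def IsSmoothAt (f : JetSpace m → E) (z₀ : JetSpace m) : Prop :=
  ∃ (k : ℕ) (g : Jet m k → E), (∀ᶠ p in 𝓝 (z₀.trunc k), ContDiffAt ℝ ∞ g p) ∧
    f =ᶠ[𝓝 z₀] fun z => g (z.trunc k)

lemma IsSmoothAt.exists_order {f : JetSpace m → E} {z₀ : JetSpace m} (hf : IsSmoothAt f z₀) :
    ∃ k, ∀ l, k ≤ l → ∃ g : Jet m l → E, (∀ᶠ p in 𝓝 (z₀.trunc l), ContDiffAt ℝ ∞ g p) ∧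
      f =ᶠ[𝓝 z₀] fun z => g (z.trunc l) := by
  obtain ⟨k, g, hg, hfg⟩ := hf
  refine ⟨k, fun l hl => ⟨g ∘ restrict hl, ?_, hfg⟩⟩
  filter_upwards [(tendsto_restrict hl z₀).eventually hg] with p hp
  exact hp.comp p (contDiff_restrict hl).contDiffAt

/-- The two notions differ in how the representation is localized: on a full preimage of a set of
finite jets, or on some neighbourhood in the infinite jet space. Such a neighbourhood may restrict
coordinates of order `l` beyond the order `k` of the representative; raising the order to `max k l`
reconciles the two. -/
lemma isDiffFunAt_iff {f : JetSpace m → ℝ} {z₀ : JetSpace m} :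
    IsDiffFunAt f z₀ ↔ IsSmoothAt f z₀ := by
  constructor
  · rintro ⟨k, U, g, hU, hz, hg, hfg⟩
    refine ⟨k, g, ?_, ?_⟩
    · filter_upwards [hU.mem_nhds hz] with p hp
      exact hg.contDiffAt (hU.mem_nhds hp)
    · filter_upwards [(continuous_trunc k).continuousAt.eventually (hU.mem_nhds hz)] with z hz
      exact hfg z hz
  · intro hf
    obtain ⟨k, hk⟩ := hf.exists_order
    obtain ⟨g₀, hg₀, hfg₀⟩ := hk k le_rfl
    obtain ⟨l, U, hU, hUf⟩ := exists_trunc_of_mem_nhds hfg₀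
    have h1 := (tendsto_restrict (le_max_right k l) z₀).eventually_mem hU
    have h2 := (tendsto_restrict (le_max_left k l) z₀).eventually hg₀
    obtain ⟨V, hV, hVo, hVz⟩ := eventually_nhds_iff.1 (h1.and h2)
    refine ⟨max k l, V, g₀ ∘ restrict (le_max_left k l), hVo, hVz, fun p hp => ?_, fun z hz => ?_⟩
    · exact ((hV p hp).2.comp p (contDiff_restrict _).contDiffAt).contDiffWithinAt
    · exact hUf z (hV _ hz).1

lemma IsSmoothAt.eventually {f : JetSpace m → E} {z₀ : JetSpace m} (hf : IsSmoothAt f z₀) :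
    ∀ᶠ z in 𝓝 z₀, IsSmoothAt f z := by
  obtain ⟨k, g, hg, hfg⟩ := hf
  filter_upwards [(continuous_trunc k).continuousAt.eventually hg.eventually_nhds,
    hfg.eventuallyEq_nhds] with z h1 h2
  exact ⟨k, g, h1, h2⟩

lemma IsSmoothAt.congr {f g : JetSpace m → E} {z₀ : JetSpace m} (hf : IsSmoothAt f z₀)
    (h : g =ᶠ[𝓝 z₀] f) : IsSmoothAt g z₀ := by
  obtain ⟨k, f', hf', hff'⟩ := hf
  exact ⟨k, f', hf', h.trans hff'⟩

lemma isSmoothAt_comp_trunc {k : ℕ} {g : Jet m k → E} {z₀ : JetSpace m}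
    (hg : ∀ᶠ p in 𝓝 (z₀.trunc k), ContDiffAt ℝ ∞ g p) : IsSmoothAt (fun z => g (z.trunc k)) z₀ :=
  ⟨k, g, hg, Filter.EventuallyEq.rfl⟩

lemma isSmoothAt_const (c : E) (z₀ : JetSpace m) : IsSmoothAt (fun _ => c) z₀ :=
  ⟨0, fun _ => c, Filter.Eventually.of_forall fun _ => contDiffAt_const, Filter.EventuallyEq.rfl⟩

lemma isSmoothAt_fst (z₀ : JetSpace m) : IsSmoothAt (fun z => z.1) z₀ :=
  ⟨0, fun p => p.1, Filter.Eventually.of_forall fun _ => contDiffAt_fst, Filter.EventuallyEq.rfl⟩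

lemma isSmoothAt_coord (a : Fin 2) (J : Fin m → ℕ) (z₀ : JetSpace m) :
    IsSmoothAt (fun z => z.2 a J) z₀ :=
  ⟨∑ i, J i, fun p => p.2 a ⟨J, le_rfl⟩,
    Filter.Eventually.of_forall fun _ => by fun_prop, Filter.EventuallyEq.rfl⟩

lemma IsSmoothAt.continuousAt {f : JetSpace m → E} {z₀ : JetSpace m} (hf : IsSmoothAt f z₀) :
    ContinuousAt f z₀ := by
  obtain ⟨k, g, hg, hfg⟩ := hf
  refine ContinuousAt.congr ?_ hfg.symm
  exact ContinuousAt.comp (f := trunc k) (g := g) hg.self_of_nhds.continuousAt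
    (continuous_trunc k).continuousAt

lemma IsSmoothAt.prodMk {f : JetSpace m → E} {g : JetSpace m → F} {z₀ : JetSpace m}
    (hf : IsSmoothAt f z₀) (hg : IsSmoothAt g z₀) : IsSmoothAt (fun z => (f z, g z)) z₀ := by
  obtain ⟨k, hk⟩ := hf.exists_order
  obtain ⟨l, hl⟩ := hg.exists_order
  obtain ⟨f', hf', hff'⟩ := hk _ (le_max_left k l)
  obtain ⟨g', hg', hgg'⟩ := hl _ (le_max_right k l)
  refine ⟨max k l, fun p => (f' p, g' p), ?_, ?_⟩
  · filter_upwards [hf', hg'] with p h1 h2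
    exact h1.prodMk h2
  · filter_upwards [hff', hgg'] with z h1 h2
    rw [h1, h2]

lemma IsSmoothAt.pi {ι : Type*} [Fintype ι] {f : ι → JetSpace m → E} {z₀ : JetSpace m}
    (hf : ∀ i, IsSmoothAt (f i) z₀) : IsSmoothAt (fun z i => f i z) z₀ := by
  choose k hk using fun i => (hf i).exists_order
  choose g hg hfg using fun i => hk i _ (Finset.le_sup (f := k) (Finset.mem_univ i))
  refine ⟨Finset.univ.sup k, fun p i => g i p, ?_, ?_⟩
  · filter_upwards [Filter.eventually_all.2 hg] with p hp
    exact contDiffAt_pi.2 hp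
  · filter_upwards [Filter.eventually_all.2 hfg] with z hz
    exact funext hz

lemma IsSmoothAt.comp_left {f : JetSpace m → E} {φ : E → F} {z₀ : JetSpace m}
    (hf : IsSmoothAt f z₀) (hφ : ∀ᶠ y in 𝓝 (f z₀), ContDiffAt ℝ ∞ φ y) :
    IsSmoothAt (fun z => φ (f z)) z₀ := by
  obtain ⟨k, g, hg, hfg⟩ := hf
  refine ⟨k, φ ∘ g, ?_, ?_⟩
  · rw [hfg.self_of_nhds] at hφ
    filter_upwards [hg, hg.self_of_nhds.continuousAt.eventually hφ] with p h1 h2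
    exact h2.comp p h1
  · filter_upwards [hfg] with z hz
    simp [hz]

lemma IsSmoothAt.comp_contDiff {f : JetSpace m → E} {φ : E → F} {z₀ : JetSpace m}
    (hf : IsSmoothAt f z₀) (hφ : ContDiff ℝ ∞ φ) : IsSmoothAt (fun z => φ (f z)) z₀ :=
  hf.comp_left (Filter.Eventually.of_forall fun _ => hφ.contDiffAt)

lemma IsSmoothAt.sub {f g : JetSpace m → E} {z₀ : JetSpace m} (hf : IsSmoothAt f z₀)
    (hg : IsSmoothAt g z₀) : IsSmoothAt (fun z => f z - g z) z₀ :=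
  (hf.prodMk hg).comp_contDiff (φ := fun p => p.1 - p.2) (by fun_prop)

lemma IsSmoothAt.mul {f g : JetSpace m → ℝ} {z₀ : JetSpace m} (hf : IsSmoothAt f z₀)
    (hg : IsSmoothAt g z₀) : IsSmoothAt (fun z => f z * g z) z₀ :=
  (hf.prodMk hg).comp_contDiff (φ := fun p => p.1 * p.2) (by fun_prop)

lemma IsSmoothAt.sum {ι : Type*} [Fintype ι] {f : ι → JetSpace m → E} {z₀ : JetSpace m}
    (hf : ∀ i, IsSmoothAt (f i) z₀) : IsSmoothAt (fun z => ∑ i, f i z) z₀ :=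
  (IsSmoothAt.pi hf).comp_contDiff (φ := fun p => ∑ i, p i) (by fun_prop)

lemma isSmoothAt_base (z₀ : JetSpace m) : IsSmoothAt (fun z => z.base) z₀ :=
  (isSmoothAt_fst z₀).prodMk (IsSmoothAt.pi fun a => isSmoothAt_coord a 0 z₀)

lemma JetSpace.continuous_base : Continuous (base (m := m)) := by
  unfold base
  fun_prop

/-! #### Derivatives along directions -/

lemma hasLineDerivAt_of_eventuallyEq_trunc {k : ℕ} {f : JetSpace m → E} {g : Jet m k → E}
    {z : JetSpace m} (hg : DifferentiableAt ℝ g (z.trunc k))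
    (hfg : f =ᶠ[𝓝 z] fun z => g (z.trunc k)) (v : JetSpace m) :
    HasLineDerivAt ℝ f (fderiv ℝ g (z.trunc k) (v.trunc k)) z v := by
  have hc : Continuous fun t : ℝ => z + t • v := by fun_prop
  have h0 : z + (0 : ℝ) • v = z := by simp
  have h1 : Filter.Tendsto (fun t : ℝ => z + t • v) (𝓝 0) (𝓝 z) := by
    simpa only [h0] using hc.tendsto 0
  have h2 : HasDerivAt (fun t : ℝ => z.trunc k + t • v.trunc k) (v.trunc k) 0 := by
    simpa using ((hasDerivAt_id (0 : ℝ)).smul_const (v.trunc k)).const_add (z.trunc k)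
  have h3 : HasDerivAt (fun t : ℝ => g (z.trunc k + t • v.trunc k))
      (fderiv ℝ g (z.trunc k) (v.trunc k)) 0 :=
    HasFDerivAt.comp_hasDerivAt (0 : ℝ) (by simpa using hg.hasFDerivAt) h2
  exact h3.congr_of_eventuallyEq (h1.eventually hfg)

/-- Line derivatives need not be additive in the direction in general. Here they are, because the
function factors locally through a finite-dimensional space; this lets `lineDeriv` serve as the
differential on the infinite product. -/
lemma IsSmoothAt.exists_linearMap {f : JetSpace m → E} {z : JetSpace m} (hf : IsSmoothAt f z) :
    ∃ L : JetSpace m →ₗ[ℝ] E, ∀ v, HasLineDerivAt ℝ f (L v) z v := by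
  obtain ⟨k, g, hg, hfg⟩ := hf
  exact ⟨(fderiv ℝ g (z.trunc k)).toLinearMap ∘ₗ truncL m k, fun v =>
    hasLineDerivAt_of_eventuallyEq_trunc (hg.self_of_nhds.differentiableAt (by simp)) hfg v⟩

lemma IsSmoothAt.hasLineDerivAt {f : JetSpace m → E} {z : JetSpace m} (hf : IsSmoothAt f z)
    (v : JetSpace m) : HasLineDerivAt ℝ f (lineDeriv ℝ f z v) z v := by
  obtain ⟨L, hL⟩ := hf.exists_linearMap
  exact (hL v).lineDifferentiableAt.hasLineDerivAt

/-- The differential of a smooth differential function, as a linear map. -/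
noncomputable def IsSmoothAt.differential {f : JetSpace m → E} {z : JetSpace m}
    (hf : IsSmoothAt f z) : JetSpace m →ₗ[ℝ] E where
  toFun := lineDeriv ℝ f z
  map_add' v w := by
    obtain ⟨L, hL⟩ := hf.exists_linearMap
    rw [(hL _).lineDeriv, (hL _).lineDeriv, (hL _).lineDeriv, map_add]
  map_smul' c v := by
    obtain ⟨L, hL⟩ := hf.exists_linearMap
    rw [(hL _).lineDeriv, (hL _).lineDeriv, map_smul, RingHom.id_apply]

lemma lineDeriv_congr {f g : JetSpace m → E} {z : JetSpace m} (h : f =ᶠ[𝓝 z] g)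
    (v : JetSpace m) : lineDeriv ℝ f z v = lineDeriv ℝ g z v := by
  have hc : Continuous fun t : ℝ => z + t • v := by fun_prop
  have h1 : Filter.Tendsto (fun t : ℝ => z + t • v) (𝓝 0) (𝓝 z) := by
    simpa using hc.tendsto 0
  exact Filter.EventuallyEq.deriv_eq (h1.eventually h)

lemma lineDeriv_comp_left {f : JetSpace m → E} {φ : E → F} {z : JetSpace m} (hf : IsSmoothAt f z)
    (hφ : DifferentiableAt ℝ φ (f z)) (v : JetSpace m) :
    lineDeriv ℝ (fun z => φ (f z)) z v = fderiv ℝ φ (f z) (lineDeriv ℝ f z v) := by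
  refine HasLineDerivAt.lineDeriv ?_
  exact HasFDerivAt.comp_hasDerivAt (0 : ℝ) (by simpa using hφ.hasFDerivAt) (hf.hasLineDerivAt v)

lemma lineDeriv_mul {f g : JetSpace m → ℝ} {z : JetSpace m} (hf : IsSmoothAt f z)
    (hg : IsSmoothAt g z) (v : JetSpace m) :
    lineDeriv ℝ (fun z => f z * g z) z v = lineDeriv ℝ f z v * g z + f z * lineDeriv ℝ g z v := by
  refine HasLineDerivAt.lineDeriv ?_
  have := HasDerivAt.mul (hf.hasLineDerivAt v) (hg.hasLineDerivAt v)
  simp only [zero_smul, add_zero] at this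
  exact this

lemma lineDeriv_sub {f g : JetSpace m → E} {z : JetSpace m} (hf : IsSmoothAt f z)
    (hg : IsSmoothAt g z) (v : JetSpace m) :
    lineDeriv ℝ (fun z => f z - g z) z v = lineDeriv ℝ f z v - lineDeriv ℝ g z v :=
  HasLineDerivAt.lineDeriv (HasDerivAt.sub (hf.hasLineDerivAt v) (hg.hasLineDerivAt v))

lemma lineDeriv_sum {ι : Type*} [Fintype ι] {f : ι → JetSpace m → E} {z : JetSpace m}
    (hf : ∀ i, IsSmoothAt (f i) z) (v : JetSpace m) :
    lineDeriv ℝ (fun z => ∑ i, f i z) z v = ∑ i, lineDeriv ℝ (f i) z v :=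
  HasLineDerivAt.lineDeriv (HasDerivAt.fun_sum fun i _ => (hf i).hasLineDerivAt v)

lemma lineDeriv_fst_apply (i : Fin m) (z v : JetSpace m) :
    lineDeriv ℝ (fun z : JetSpace m => z.1 i) z v = v.1 i := by
  refine HasLineDerivAt.lineDeriv ?_
  have := ((hasDerivAt_id (0 : ℝ)).smul_const (v.1 i)).const_add (z.1 i)
  simpa [HasLineDerivAt] using this

lemma lineDeriv_coord (a : Fin 2) (J : Fin m → ℕ) (z v : JetSpace m) :
    lineDeriv ℝ (fun z : JetSpace m => z.2 a J) z v = v.2 a J := by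
  refine HasLineDerivAt.lineDeriv ?_
  have := ((hasDerivAt_id (0 : ℝ)).smul_const (v.2 a J)).const_add (z.2 a J)
  simpa [HasLineDerivAt] using this

/-- The components of a map or vector field on the jet space are smooth. -/
def IsSmoothMapAt (P : JetSpace m → JetSpace m) (z₀ : JetSpace m) : Prop :=
  (∀ i, IsSmoothAt (fun z => (P z).1 i) z₀) ∧ ∀ a J, IsSmoothAt (fun z => (P z).2 a J) z₀

lemma IsSmoothMapAt.trunc {P : JetSpace m → JetSpace m} {z₀ : JetSpace m}
    (hP : IsSmoothMapAt P z₀) (k : ℕ) : IsSmoothAt (fun z => (P z).trunc k) z₀ :=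
  (IsSmoothAt.pi hP.1).prodMk (IsSmoothAt.pi fun a => IsSmoothAt.pi fun J => hP.2 a J.1)

lemma IsSmoothMapAt.continuousAt {P : JetSpace m → JetSpace m} {z₀ : JetSpace m}
    (hP : IsSmoothMapAt P z₀) : ContinuousAt P z₀ :=
  ContinuousAt.prodMk (f := fun z => (P z).1) (g := fun z => (P z).2)
    (continuousAt_pi.2 fun i => (hP.1 i).continuousAt)
    (continuousAt_pi.2 fun a => continuousAt_pi.2 fun J => (hP.2 a J).continuousAt)

lemma IsSmoothAt.comp {f : JetSpace m → E} {P : JetSpace m → JetSpace m} {z₀ : JetSpace m}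
    (hf : IsSmoothAt f (P z₀)) (hP : IsSmoothMapAt P z₀) : IsSmoothAt (fun z => f (P z)) z₀ := by
  obtain ⟨k, g, hg, hfg⟩ := hf
  exact ((hP.trunc k).comp_left hg).congr (hP.continuousAt.eventually hfg)

/-- The image of a direction under the differential of a map of the jet space. -/
noncomputable def pushDirection (P : JetSpace m → JetSpace m) (z v : JetSpace m) : JetSpace m :=
  (fun i => lineDeriv ℝ (fun z => (P z).1 i) z v,
    fun a J => lineDeriv ℝ (fun z => (P z).2 a J) z v)

lemma lineDeriv_trunc {P : JetSpace m → JetSpace m} {z : JetSpace m} (hP : IsSmoothMapAt P z)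
    (k : ℕ) (v : JetSpace m) :
    lineDeriv ℝ (fun z => (P z).trunc k) z v = (pushDirection P z v).trunc k := by
  refine HasLineDerivAt.lineDeriv ?_
  refine HasDerivAt.prodMk (hasDerivAt_pi.2 fun i => (hP.1 i).hasLineDerivAt v)
    (hasDerivAt_pi.2 fun a => hasDerivAt_pi.2 fun J => (hP.2 a J.1).hasLineDerivAt v)

/-- The chain rule. -/
lemma lineDeriv_comp {f : JetSpace m → E} {P : JetSpace m → JetSpace m} {z : JetSpace m}
    (hf : IsSmoothAt f (P z)) (hP : IsSmoothMapAt P z) (v : JetSpace m) :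
    lineDeriv ℝ (fun z => f (P z)) z v = lineDeriv ℝ f (P z) (pushDirection P z v) := by
  obtain ⟨k, g, hg, hfg⟩ := hf
  have hgd : DifferentiableAt ℝ g ((P z).trunc k) := hg.self_of_nhds.differentiableAt (by simp)
  have h1 : (fun z => f (P z)) =ᶠ[𝓝 z] fun z => g ((P z).trunc k) :=
    hP.continuousAt.eventually hfg
  rw [lineDeriv_congr h1,
    lineDeriv_comp_left (φ := g) (f := fun z => (P z).trunc k) (hP.trunc k) hgd,
    lineDeriv_trunc hP, (hasLineDerivAt_of_eventuallyEq_trunc hgd hfg _).lineDeriv]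

/-- The local form of the derivative of a differential function along a vector field. -/
lemma eventuallyEq_lineDeriv {k : ℕ} {f : JetSpace m → E} {g : Jet m k → E} {z₀ : JetSpace m}
    (hg : ∀ᶠ p in 𝓝 (z₀.trunc k), ContDiffAt ℝ ∞ g p)
    (hfg : f =ᶠ[𝓝 z₀] fun z => g (z.trunc k)) (Y : JetSpace m → JetSpace m) :
    (fun z => lineDeriv ℝ f z (Y z)) =ᶠ[𝓝 z₀]
      fun z => fderiv ℝ g (z.trunc k) ((Y z).trunc k) := by
  filter_upwards [(continuous_trunc k).continuousAt.eventually hg, hfg.eventuallyEq_nhds]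
    with z h1 h2
  exact (hasLineDerivAt_of_eventuallyEq_trunc (h1.differentiableAt (by simp)) h2 _).lineDeriv

lemma IsSmoothAt.fderiv_trunc {k : ℕ} {g : Jet m k → E} {z₀ : JetSpace m}
    (hg : ∀ᶠ p in 𝓝 (z₀.trunc k), ContDiffAt ℝ ∞ g p) :
    IsSmoothAt (fun z => fderiv ℝ g (z.trunc k)) z₀ := by
  refine isSmoothAt_comp_trunc ?_
  filter_upwards [hg] with p hp
  exact hp.fderiv_right le_rfl

lemma IsSmoothAt.lineDeriv {f : JetSpace m → E} {Y : JetSpace m → JetSpace m} {z₀ : JetSpace m}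
    (hf : IsSmoothAt f z₀) (hY : IsSmoothMapAt Y z₀) :
    IsSmoothAt (fun z => lineDeriv ℝ f z (Y z)) z₀ := by
  obtain ⟨k, g, hg, hfg⟩ := hf
  refine IsSmoothAt.congr ?_ (eventuallyEq_lineDeriv hg hfg Y)
  exact ((IsSmoothAt.fderiv_trunc hg).prodMk (hY.trunc k)).comp_contDiff (φ := fun p => p.1 p.2)
    (by fun_prop)

/-- Derivatives along two vector fields commute up to the derivative along their bracket. -/
lemma lineDeriv_lineDeriv_sub {f : JetSpace m → E} {Y Z : JetSpace m → JetSpace m}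
    {z : JetSpace m} (hf : IsSmoothAt f z) (hY : IsSmoothMapAt Y z) (hZ : IsSmoothMapAt Z z) :
    lineDeriv ℝ (fun z => lineDeriv ℝ f z (Z z)) z (Y z)
        - lineDeriv ℝ (fun z => lineDeriv ℝ f z (Y z)) z (Z z)
      = lineDeriv ℝ f z (pushDirection Z z (Y z) - pushDirection Y z (Z z)) := by
  obtain ⟨k, g, hg, hfg⟩ := hf
  have hgz : ContDiffAt ℝ ∞ g (z.trunc k) := hg.self_of_nhds
  have hg1 : DifferentiableAt ℝ g (z.trunc k) := hgz.differentiableAt (by simp)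
  have hg2 : DifferentiableAt ℝ (fderiv ℝ g) (z.trunc k) :=
    (hgz.fderiv_right (m := ∞) le_rfl).differentiableAt (by simp)
  -- A second derivative splits into the Hessian of `g` and `dg` applied to the derivative of the
  -- field. The Hessian terms cancel by symmetry, leaving the bracket.
  have key : ∀ W : JetSpace m → JetSpace m, IsSmoothMapAt W z → ∀ v : JetSpace m,
      lineDeriv ℝ (fun z => lineDeriv ℝ f z (W z)) z v
        = fderiv ℝ (fderiv ℝ g) (z.trunc k) (v.trunc k) ((W z).trunc k)
          + fderiv ℝ g (z.trunc k) ((pushDirection W z v).trunc k) := by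
    intro W hW v
    rw [lineDeriv_congr (eventuallyEq_lineDeriv hg hfg W)]
    refine HasLineDerivAt.lineDeriv ?_
    have h1 : HasLineDerivAt ℝ (fun z => fderiv ℝ g (z.trunc k))
        (fderiv ℝ (fderiv ℝ g) (z.trunc k) (v.trunc k)) z v :=
      hasLineDerivAt_of_eventuallyEq_trunc hg2 Filter.EventuallyEq.rfl v
    have h2 := (hW.trunc k).hasLineDerivAt v
    rw [lineDeriv_trunc hW] at h2
    have h3 := HasDerivAt.clm_apply h1 h2
    simp only [zero_smul, add_zero] at h3
    exact h3
  have hsymm : IsSymmSndFDerivAt ℝ g (z.trunc k) :=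
    hgz.isSymmSndFDerivAt (by
      rw [minSmoothness_of_isRCLikeNormedField]; exact WithTop.coe_le_coe.2 (le_top (a := (2 : ℕ∞))))
  rw [key Z hZ, key Y hY, hsymm.eq,
    (hasLineDerivAt_of_eventuallyEq_trunc hg1 hfg _).lineDeriv]
  have : (pushDirection Z z (Y z) - pushDirection Y z (Z z)).trunc k
    = (pushDirection Z z (Y z)).trunc k - (pushDirection Y z (Z z)).trunc k := rfl
  rw [this, map_sub]
  abel

end JetCalculus

/-! ### Total derivatives and prolongations -/

section Prolongation

open JetSpace

variable {m : ℕ}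

/-! #### Iterated operators -/

/-- With `D' = D` and a relation that ignores its second argument, this also propagates invariants
such as smoothness through iterated operators. -/
lemma foldr_iterate_rel {α β : Type*} {D : Fin m → α → α} {D' : Fin m → β → β} {R : α → β → Prop}
    (h : ∀ i F G, R F G → R (D i F) (D' i G)) (J : Fin m → ℕ) {F : α} {G : β} (hFG : R F G)
    (l : List (Fin m)) :
    R (l.foldr (fun i H => (D i)^[J i] H) F) (l.foldr (fun i H => (D' i)^[J i] H) G) := by
  induction l with
  | nil => exact hFG
  | cons a l ih =>
    simp only [List.foldr_cons]
    generalize J a = n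
    induction n with
    | zero => exact ih
    | succ n ihn =>
      rw [Function.iterate_succ_apply', Function.iterate_succ_apply']
      exact h _ _ _ ihn

/-- A relation which is compatible with two families of operators is compatible with their
iterates. -/
lemma multiPow_rel {α β : Type*} {D : Fin m → α → α} {D' : Fin m → β → β} {R : α → β → Prop}
    (h : ∀ i F G, R F G → R (D i F) (D' i G)) (J : Fin m → ℕ) {F : α} {G : β} (hFG : R F G) :
    R (multiPow D J F) (multiPow D' J G) :=
  foldr_iterate_rel h J hFG _

lemma multiPow_zero {α : Type*} (D : Fin m → α → α) (F : α) : multiPow D 0 F = F := by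
  unfold multiPow
  induction List.finRange m with
  | nil => rfl
  | cons a l ih => simp

/-- Smooth differential functions on a set. -/
def SmoothOn (F : JetSpace m → ℝ) (W : Set (JetSpace m)) : Prop := ∀ z ∈ W, IsSmoothAt F z

/-- Raising one exponent of an iterate of commuting operators. -/
lemma apply_multiPow {W : Set (JetSpace m)} {D : Fin m → (JetSpace m → ℝ) → JetSpace m → ℝ}
    (hsmooth : ∀ i F, SmoothOn F W → SmoothOn (D i F) W)
    (hcongr : ∀ i F G, Set.EqOn F G W → Set.EqOn (D i F) (D i G) W)
    (hcomm : ∀ i j F, SmoothOn F W → Set.EqOn (D i (D j F)) (D j (D i F)) W)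
    (i : Fin m) (J : Fin m → ℕ) {F : JetSpace m → ℝ} (hF : SmoothOn F W) :
    Set.EqOn (D i (multiPow D J F)) (multiPow D (J + Pi.single i 1) F) W := by
  have hout : ∀ l : List (Fin m), i ∉ l →
      l.foldr (fun j H => (D j)^[(J + Pi.single i 1 : Fin m → ℕ) j] H) F
        = l.foldr (fun j H => (D j)^[J j] H) F := by
    intro l
    induction l with
    | nil => exact fun _ => rfl
    | cons a l ih =>
      intro hi
      rw [List.mem_cons, not_or] at hi
      simp only [List.foldr_cons]
      rw [ih hi.2]
      simp [Ne.symm hi.1]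
  have key : ∀ l : List (Fin m), l.Nodup → i ∈ l →
      Set.EqOn (D i (l.foldr (fun j H => (D j)^[J j] H) F))
        (l.foldr (fun j H => (D j)^[(J + Pi.single i 1 : Fin m → ℕ) j] H) F) W := by
    intro l
    induction l with
    | nil => exact fun _ h => absurd h List.not_mem_nil
    | cons a l ih =>
      intro hnd hi
      rw [List.nodup_cons] at hnd
      simp only [List.foldr_cons]
      rcases List.mem_cons.1 hi with rfl | hil
      · rw [hout l hnd.1, Pi.add_apply, Pi.single_eq_same, Function.iterate_succ_apply']
        exact fun _ _ => rfl
      · have hai : a ≠ i := fun h => hnd.1 (h ▸ hil)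
        rw [Pi.add_apply, Pi.single_eq_of_ne hai, add_zero]
        have hs : SmoothOn (l.foldr (fun j H => (D j)^[J j] H) F) W :=
          foldr_iterate_rel (D := D) (D' := D) (R := fun F _ => SmoothOn F W)
            (fun i F _ h => hsmooth i F h) J (G := F) hF l
        have ihl := ih hnd.2 hil
        generalize J a = n
        -- Moving `D i` past each `D a` requires smoothness of the intermediate iterate, so it is
        -- carried through the induction.
        have h1 : SmoothOn ((D a)^[n] (l.foldr (fun j H => (D j)^[J j] H) F)) W ∧
            Set.EqOn (D i ((D a)^[n] (l.foldr (fun j H => (D j)^[J j] H) F)))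
            ((D a)^[n] (l.foldr (fun j H => (D j)^[(J + Pi.single i 1 : Fin m → ℕ) j] H) F)) W := by
          induction n with
          | zero => exact ⟨hs, ihl⟩
          | succ n ihn =>
            simp only [Function.iterate_succ_apply']
            exact ⟨hsmooth _ _ ihn.1, (hcomm i a _ ihn.1).trans (hcongr a _ _ ihn.2)⟩
        exact h1.2
  exact key _ (List.nodup_finRange m) (List.mem_finRange i)

/-! #### Total derivatives -/

/-- The direction of the total derivative `D_i`. -/
def totalDirection (i : Fin m) (z : JetSpace m) : JetSpace m :=
  (Pi.single i 1, fun a J => z.2 a (J + Pi.single i 1))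

lemma totalDeriv_eq (i : Fin m) (F : JetSpace m → ℝ) (z : JetSpace m) :
    totalDeriv i F z = lineDeriv ℝ F z (totalDirection i z) := rfl

lemma isSmoothMapAt_totalDirection (i : Fin m) (z : JetSpace m) :
    IsSmoothMapAt (totalDirection i) z :=
  ⟨fun _ => isSmoothAt_const _ z, fun a _ => isSmoothAt_coord a _ z⟩

lemma IsSmoothAt.totalDeriv {F : JetSpace m → ℝ} {z : JetSpace m} (hF : IsSmoothAt F z)
    (i : Fin m) : IsSmoothAt (totalDeriv i F) z :=
  hF.lineDeriv (isSmoothMapAt_totalDirection i z)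

lemma totalDeriv_congr {F G : JetSpace m → ℝ} {z : JetSpace m} (h : F =ᶠ[𝓝 z] G) (i : Fin m) :
    totalDeriv i F z = totalDeriv i G z :=
  lineDeriv_congr h _

lemma totalDeriv_congr_on {F G : JetSpace m → ℝ} {W : Set (JetSpace m)} (hW : IsOpen W)
    (h : Set.EqOn F G W) (i : Fin m) : Set.EqOn (totalDeriv i F) (totalDeriv i G) W :=
  fun _ hz => totalDeriv_congr (h.eventuallyEq_of_mem (hW.mem_nhds hz)) i

/-- The bracket of the two total directions vanishes: differentiating `u_{J + e_j}` along `D_i` and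
`u_{J + e_i}` along `D_j` both give `u_{J + e_i + e_j}`. -/
lemma totalDeriv_comm {F : JetSpace m → ℝ} {z : JetSpace m} (hF : IsSmoothAt F z) (i j : Fin m) :
    totalDeriv i (totalDeriv j F) z = totalDeriv j (totalDeriv i F) z := by
  rw [← sub_eq_zero]
  have h := lineDeriv_lineDeriv_sub hF (isSmoothMapAt_totalDirection i z)
    (isSmoothMapAt_totalDirection j z)
  refine h.trans ?_
  have h0 : pushDirection (totalDirection j) z (totalDirection i z)
      - pushDirection (totalDirection i) z (totalDirection j z) = 0 := by
    rw [sub_eq_zero]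
    refine Prod.ext (funext fun l => ?_) (funext fun a => funext fun J => ?_)
    · simp [pushDirection, totalDirection, lineDeriv]
    · simp only [pushDirection, totalDirection, lineDeriv_coord]
      rw [add_right_comm]
  rw [h0]
  exact hF.differential.map_zero

lemma totalDeriv_coord (i : Fin m) (a : Fin 2) (J : Fin m → ℕ) :
    totalDeriv i (fun z => z.2 a J) = fun z => z.2 a (J + Pi.single i 1) :=
  funext fun z => lineDeriv_coord a J z _

lemma multiPow_totalDeriv_coord (J : Fin m → ℕ) (a : Fin 2) :
    multiPow totalDeriv J (fun z : JetSpace m => z.2 a 0) = fun z => z.2 a J := by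
  have key : ∀ l : List (Fin m), l.foldr (fun i H => (totalDeriv i)^[J i] H)
      (fun z : JetSpace m => z.2 a 0) = fun z => z.2 a ((l.map fun i => Pi.single i (J i)).sum) := by
    intro l
    induction l with
    | nil => rfl
    | cons i l ih =>
      rw [List.foldr_cons, ih, List.map_cons, List.sum_cons]
      generalize (l.map fun i => (Pi.single i (J i) : Fin m → ℕ)).sum = K
      generalize J i = n
      induction n with
      | zero => simp
      | succ n ihn =>
        rw [Function.iterate_succ_apply', ihn, totalDeriv_coord]
        funext z
        rw [add_right_comm, ← Pi.single_add]
  unfold multiPow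
  rw [key]
  have h : ((List.finRange m).map fun i => (Pi.single i (J i) : Fin m → ℕ)).sum = J := by
    rw [← List.ofFn_eq_map, List.sum_ofFn, Finset.univ_sum_single]
  rw [h]

/-! #### Smoothness of matrix operations -/

lemma IsSmoothAt.prod {ι : Type*} (s : Finset ι) {f : ι → JetSpace m → ℝ} {z : JetSpace m}
    (hf : ∀ i, IsSmoothAt (f i) z) : IsSmoothAt (fun z => ∏ i ∈ s, f i z) z := by
  classical
  induction s using Finset.induction_on with
  | empty => simpa using isSmoothAt_const (1 : ℝ) z
  | insert a s ha ih =>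
    simp only [Finset.prod_insert ha]
    exact (hf a).mul ih

lemma IsSmoothAt.det {M : JetSpace m → Matrix (Fin m) (Fin m) ℝ} {z : JetSpace m}
    (hM : ∀ i j, IsSmoothAt (fun z => M z i j) z) : IsSmoothAt (fun z => (M z).det) z := by
  simp only [Matrix.det_apply']
  exact IsSmoothAt.sum fun σ => (isSmoothAt_const _ z).mul (IsSmoothAt.prod _ fun i => hM _ _)

lemma IsSmoothAt.inv {f : JetSpace m → ℝ} {z : JetSpace m} (hf : IsSmoothAt f z) (h0 : f z ≠ 0) :
    IsSmoothAt (fun z => (f z)⁻¹) z := by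
  refine hf.comp_left ?_
  filter_upwards [isOpen_ne.mem_nhds h0] with y hy
  exact contDiffAt_inv ℝ hy

lemma IsSmoothAt.matrix_inv {M : JetSpace m → Matrix (Fin m) (Fin m) ℝ} {z : JetSpace m}
    (hM : ∀ i j, IsSmoothAt (fun z => M z i j) z) (h : IsUnit (M z).det) (i j : Fin m) :
    IsSmoothAt (fun z => (M z)⁻¹ i j) z := by
  simp only [Matrix.inv_def, Matrix.smul_apply, Ring.inverse_eq_inv', Matrix.adjugate_apply,
    smul_eq_mul]
  refine ((IsSmoothAt.det hM).inv h.ne_zero).mul (IsSmoothAt.det fun k l => ?_)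
  by_cases hk : k = j
  · subst hk
    simpa using isSmoothAt_const _ z
  · simpa [Matrix.updateRow_ne hk] using hM k l

/-! #### Total derivatives with respect to new variables -/

/-- `T` is smooth and `(D_j X̄^l)` is invertible on the open set `W`. -/
structure RegularOn (T : BaseSpace m → BaseSpace m) (W : Set (JetSpace m)) : Prop where
  isOpen : IsOpen W
  smooth : ∀ z ∈ W, ∀ᶠ b in 𝓝 z.base, ContDiffAt ℝ ∞ T b
  isUnit : ∀ z ∈ W, IsUnit (totalJacobian T z).det

variable {T : BaseSpace m → BaseSpace m} {W : Set (JetSpace m)}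

lemma isSmoothAt_fst_base {z : JetSpace m} (hT : ∀ᶠ b in 𝓝 z.base, ContDiffAt ℝ ∞ T b)
    (l : Fin m) : IsSmoothAt (fun y => (T y.base).1 l) z := by
  refine (isSmoothAt_base z).comp_left (φ := fun b => (T b).1 l) ?_
  filter_upwards [hT] with b hb
  exact contDiffAt_pi.1 hb.fst l

lemma isSmoothAt_snd_base {z : JetSpace m} (hT : ∀ᶠ b in 𝓝 z.base, ContDiffAt ℝ ∞ T b)
    (a : Fin 2) : IsSmoothAt (fun y => (T y.base).2 a) z := by
  refine (isSmoothAt_base z).comp_left (φ := fun b => (T b).2 a) ?_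
  filter_upwards [hT] with b hb
  exact contDiffAt_pi.1 hb.snd a

lemma isSmoothAt_totalJacobian {z : JetSpace m} (hT : ∀ᶠ b in 𝓝 z.base, ContDiffAt ℝ ∞ T b)
    (j l : Fin m) : IsSmoothAt (fun z => totalJacobian T z j l) z :=
  (isSmoothAt_fst_base hT l).totalDeriv j

/-- The direction of the total derivative with respect to a new variable. -/
noncomputable def newDirection (T : BaseSpace m → BaseSpace m) (l : Fin m) (z : JetSpace m) :
    JetSpace m :=
  ∑ j, (totalJacobian T z)⁻¹ l j • totalDirection j z

lemma newTotalDeriv_eq {F : JetSpace m → ℝ} {z : JetSpace m} (hF : IsSmoothAt F z) (l : Fin m) :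
    newTotalDeriv T l F z = lineDeriv ℝ F z (newDirection T l z) := by
  have h := map_sum hF.differential
    (fun j => (totalJacobian T z)⁻¹ l j • totalDirection j z) Finset.univ
  simp only [map_smul] at h
  exact h.symm

lemma newTotalDeriv_congr {F G : JetSpace m → ℝ} {z : JetSpace m} (h : F =ᶠ[𝓝 z] G) (l : Fin m) :
    newTotalDeriv T l F z = newTotalDeriv T l G z := by
  unfold newTotalDeriv
  simp only [totalDeriv_congr h]

namespace RegularOn

lemma newTotalDeriv_congr_on (h : RegularOn T W) (l : Fin m) (F G : JetSpace m → ℝ)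
    (hFG : Set.EqOn F G W) : Set.EqOn (newTotalDeriv T l F) (newTotalDeriv T l G) W :=
  fun _ hz => newTotalDeriv_congr (hFG.eventuallyEq_of_mem (h.isOpen.mem_nhds hz)) l

lemma smoothOn_newTotalDeriv (h : RegularOn T W) (l : Fin m) (F : JetSpace m → ℝ)
    (hF : SmoothOn F W) : SmoothOn (newTotalDeriv T l F) W := fun z hz =>
  IsSmoothAt.sum fun j => (IsSmoothAt.matrix_inv
    (fun _ _ => isSmoothAt_totalJacobian (h.smooth z hz) _ _) (h.isUnit z hz) l j).mul
      ((hF z hz).totalDeriv j)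

lemma totalDeriv_eq_sum (h : RegularOn T W) {z : JetSpace m} (hz : z ∈ W) (F : JetSpace m → ℝ)
    (j : Fin m) : totalDeriv j F z = ∑ l, totalJacobian T z j l * newTotalDeriv T l F z := by
  have h1 : (totalJacobian T z).mulVec
      ((totalJacobian T z)⁻¹.mulVec fun k => totalDeriv k F z) = fun k => totalDeriv k F z := by
    rw [Matrix.mulVec_mulVec, Matrix.mul_nonsing_inv _ (h.isUnit z hz), Matrix.one_mulVec]
  exact (congrFun h1 j).symm

/-- Identities for the `D̄_l` are proved by contracting with the invertible Jacobian, after which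
they become identities for the `D_j`. -/
lemma cancel (h : RegularOn T W) {z : JetSpace m} (hz : z ∈ W) {x y : Fin m → ℝ}
    (hxy : ∀ j, ∑ l, totalJacobian T z j l * x l = ∑ l, totalJacobian T z j l * y l) : x = y := by
  have h1 : (totalJacobian T z).mulVec x = (totalJacobian T z).mulVec y := funext hxy
  have h2 := congrArg ((totalJacobian T z)⁻¹.mulVec) h1
  rwa [Matrix.mulVec_mulVec, Matrix.mulVec_mulVec, Matrix.nonsing_inv_mul _ (h.isUnit z hz),
    Matrix.one_mulVec, Matrix.one_mulVec] at h2

lemma eventuallyEq_sum (h : RegularOn T W) {z : JetSpace m} (hz : z ∈ W) (F : JetSpace m → ℝ)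
    (j : Fin m) :
    totalDeriv j F =ᶠ[𝓝 z] fun z => ∑ l, totalJacobian T z j l * newTotalDeriv T l F z := by
  filter_upwards [h.isOpen.mem_nhds hz] with y hy
  exact h.totalDeriv_eq_sum hy F j

/-- The derivative along a direction of `D_j F`, expressed through new total derivatives. -/
lemma lineDeriv_totalDeriv (h : RegularOn T W) {z : JetSpace m} (hz : z ∈ W)
    {F : JetSpace m → ℝ} (hF : SmoothOn F W) (j : Fin m) (v : JetSpace m) :
    lineDeriv ℝ (totalDeriv j F) z v = ∑ l,
      (lineDeriv ℝ (fun z => totalJacobian T z j l) z v * newTotalDeriv T l F z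
        + totalJacobian T z j l * lineDeriv ℝ (newTotalDeriv T l F) z v) := by
  have hA : ∀ l, IsSmoothAt (fun z => totalJacobian T z j l) z := fun l =>
    isSmoothAt_totalJacobian (h.smooth z hz) j l
  have hD : ∀ l, IsSmoothAt (newTotalDeriv T l F) z := fun l =>
    h.smoothOn_newTotalDeriv l F hF z hz
  rw [lineDeriv_congr (h.eventuallyEq_sum hz F j), lineDeriv_sum fun l => (hA l).mul (hD l)]
  exact Finset.sum_congr rfl fun l _ => lineDeriv_mul (hA l) (hD l) v

/-- Let `A` be the total Jacobian and `C` the matrix of the `D̄_k D̄_l F`. Then `D_i D_j F = ∑_l D_i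
A_{jl} · D̄_l F + (A C Aᵀ)_{ij}`. The left side is symmetric in `i, j`, and so is the first sum
because `A_{jl} = D_j X̄^l`. Thus `A C Aᵀ` is symmetric, and so is `C`. -/
lemma newTotalDeriv_comm (h : RegularOn T W) (k l : Fin m) (F : JetSpace m → ℝ)
    (hF : SmoothOn F W) :
    Set.EqOn (newTotalDeriv T k (newTotalDeriv T l F))
      (newTotalDeriv T l (newTotalDeriv T k F)) W := by
  intro z hz
  set A := totalJacobian T z with hA
  set C : Matrix (Fin m) (Fin m) ℝ :=
    Matrix.of fun k l => newTotalDeriv T k (newTotalDeriv T l F) z with hC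
  have h1 : ∀ i j, totalDeriv i (totalDeriv j F) z
      = (∑ l, totalDeriv i (fun z => totalJacobian T z j l) z * newTotalDeriv T l F z)
        + (A * C * A.transpose) i j := by
    intro i j
    refine (h.lineDeriv_totalDeriv hz hF j (totalDirection i z)).trans ?_
    rw [Finset.sum_add_distrib]
    refine congrArg₂ (· + ·) rfl ?_
    rw [Matrix.mul_apply]
    refine Finset.sum_congr rfl fun l _ => ?_
    rw [Matrix.transpose_apply, mul_comm, Matrix.mul_apply]
    refine congrArg₂ (· * ·) ?_ rfl
    exact h.totalDeriv_eq_sum hz (newTotalDeriv T l F) i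
  have h2 : A * C * A.transpose = (A * C * A.transpose).transpose := by
    ext i j
    have h3 := totalDeriv_comm (hF z hz) i j
    rw [h1 i j, h1 j i] at h3
    have h4 : ∀ l, totalDeriv i (fun z => totalJacobian T z j l) z
        = totalDeriv j (fun z => totalJacobian T z i l) z := fun l =>
      totalDeriv_comm (isSmoothAt_fst_base (h.smooth z hz) l) i j
    simp only [h4] at h3
    exact add_left_cancel h3
  rw [Matrix.transpose_mul, Matrix.transpose_mul, Matrix.transpose_transpose, Matrix.mul_assoc] at h2
  have hu : IsUnit A.det := h.isUnit z hz
  have h3 : C = C.transpose := by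
    have h5 := congrArg (fun M => A⁻¹ * M * A.transpose⁻¹) h2
    have hu' : IsUnit A.transpose.det := by rwa [Matrix.det_transpose]
    simpa only [Matrix.mul_assoc, Matrix.mul_nonsing_inv _ hu', Matrix.mul_one,
      Matrix.nonsing_inv_mul_cancel_left _ _ hu] using h5
  exact congrFun (congrFun h3 k) l

/-! #### The prolongation of a point transformation -/

lemma smoothOn_multiPow (h : RegularOn T W) (J : Fin m → ℕ) {F : JetSpace m → ℝ}
    (hF : SmoothOn F W) : SmoothOn (multiPow (newTotalDeriv T) J F) W :=
  multiPow_rel (D := newTotalDeriv T) (D' := newTotalDeriv T) (R := fun F _ => SmoothOn F W)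
    (fun l F _ hF => h.smoothOn_newTotalDeriv l F hF) J (G := F) hF

lemma isSmoothMapAt_prolongMap (h : RegularOn T W) {z : JetSpace m} (hz : z ∈ W) :
    IsSmoothMapAt (prolongMap T) z :=
  ⟨fun l => isSmoothAt_fst_base (h.smooth z hz) l, fun a J =>
    h.smoothOn_multiPow J (fun y hy => isSmoothAt_snd_base (h.smooth y hy) a) z hz⟩

lemma prolongMap_add_single (h : RegularOn T W) {z : JetSpace m} (hz : z ∈ W) (a : Fin 2)
    (J : Fin m → ℕ) (l : Fin m) :
    (prolongMap T z).2 a (J + Pi.single l 1)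
      = newTotalDeriv T l (fun z => (prolongMap T z).2 a J) z :=
  (apply_multiPow h.smoothOn_newTotalDeriv h.newTotalDeriv_congr_on h.newTotalDeriv_comm l J
    (fun y hy => isSmoothAt_snd_base (h.smooth y hy) a) hz).symm

end RegularOn

lemma prolongMap_base (T : BaseSpace m → BaseSpace m) (z : JetSpace m) :
    (prolongMap T z).base = T z.base := by
  unfold prolongMap base
  simp only [multiPow_zero]

namespace RegularOn

/-- Prolonged maps preserve the span of the total directions. On the `u` coordinates this is the
recursion `ū_{J + e_l} = D̄_l ū_J` together with `D_j = ∑_l (D_j X̄^l) D̄_l`. -/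
lemma pushDirection_totalDirection (h : RegularOn T W) {z : JetSpace m} (hz : z ∈ W) (j : Fin m) :
    pushDirection (prolongMap T) z (totalDirection j z)
      = ∑ l, totalJacobian T z j l • totalDirection l (prolongMap T z) := by
  refine Prod.ext (funext fun i => ?_) (funext fun a => funext fun J => ?_)
  · rw [Prod.fst_sum, Finset.sum_apply]
    have : ∀ l, (totalJacobian T z j l • totalDirection l (prolongMap T z)).1 i
        = if i = l then totalJacobian T z j l else 0 := by
      intro l
      simp [totalDirection, Pi.single_apply]
    simp only [this, Finset.sum_ite_eq, Finset.mem_univ, if_true]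
    rfl
  · rw [Prod.snd_sum, Finset.sum_apply, Finset.sum_apply]
    have : ∀ l, (totalJacobian T z j l • totalDirection l (prolongMap T z)).2 a J
        = totalJacobian T z j l * newTotalDeriv T l (fun z => (prolongMap T z).2 a J) z := by
      intro l
      rw [← h.prolongMap_add_single hz]
      rfl
    simp only [this]
    exact h.totalDeriv_eq_sum hz _ j

/-- The chain rule `D̄_l (F ∘ P) = (D_l F) ∘ P`. -/
lemma newTotalDeriv_comp (h : RegularOn T W) {z : JetSpace m} (hz : z ∈ W) {F : JetSpace m → ℝ}
    (hF : IsSmoothAt F (prolongMap T z)) (l : Fin m) :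
    newTotalDeriv T l (fun z => F (prolongMap T z)) z = totalDeriv l F (prolongMap T z) := by
  have hP := h.isSmoothMapAt_prolongMap hz
  refine congrFun (h.cancel hz
    (x := fun l => newTotalDeriv T l (fun z => F (prolongMap T z)) z)
    (y := fun l => totalDeriv l F (prolongMap T z)) fun j => ?_) l
  rw [← h.totalDeriv_eq_sum hz, totalDeriv_eq, lineDeriv_comp hF hP,
    h.pushDirection_totalDirection hz]
  have h1 := map_sum hF.differential
    (fun l => totalJacobian T z j l • totalDirection l (prolongMap T z)) Finset.univ
  simp only [map_smul] at h1
  exact h1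

end RegularOn

end Prolongation

section Naturality

open JetSpace

variable {m : ℕ}

/-! ### The inverse of a prolonged point transformation -/

/-- The domain of the prolongation of a local point transformation. -/
def regularSet (T : OpenPartialHomeomorph (BaseSpace m) (BaseSpace m)) : Set (JetSpace m) :=
  {z | z.base ∈ T.source ∧ IsUnit (totalJacobian T z).det}

lemma eventually_contDiffAt {X Y : Type*} [NormedAddCommGroup X] [NormedSpace ℝ X]
    [NormedAddCommGroup Y] [NormedSpace ℝ Y] {f : X → Y} {s : Set X} (hs : IsOpen s)
    (hf : ContDiffOn ℝ ∞ f s) {x : X} (hx : x ∈ s) : ∀ᶠ y in 𝓝 x, ContDiffAt ℝ ∞ f y := by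
  filter_upwards [hs.mem_nhds hx] with y hy
  exact hf.contDiffAt (hs.mem_nhds hy)

variable {T : OpenPartialHomeomorph (BaseSpace m) (BaseSpace m)}

lemma regularOn_regularSet (hT : ContDiffOn ℝ ∞ T T.source) : RegularOn T (regularSet T) where
  isOpen := by
    refine isOpen_iff_mem_nhds.2 fun z hz => ?_
    have h1 : ContinuousAt (fun z => (totalJacobian T z).det) z :=
      (IsSmoothAt.det fun i j => isSmoothAt_totalJacobian
        (eventually_contDiffAt T.open_source hT hz.1) i j).continuousAt
    filter_upwards [continuous_base.continuousAt.eventually (T.open_source.mem_nhds hz.1),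
      h1.eventually_ne hz.2.ne_zero] with y hy1 hy2
    exact ⟨hy1, isUnit_iff_ne_zero.2 hy2⟩
  smooth z hz := eventually_contDiffAt T.open_source hT hz.1
  isUnit z hz := hz.2

lemma base_prolongMap_mem {z : JetSpace m} (hz : z ∈ regularSet T) :
    (prolongMap T z).base ∈ T.target := by
  rw [prolongMap_base]
  exact T.map_source hz.1

/-- The first components of `T.symm` pull back to the coordinates `x_l`, and `D̄_j x_l` is by
definition an entry of the inverse Jacobian. -/
lemma totalJacobian_symm_prolongMap (hT : ContDiffOn ℝ ∞ T T.source)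
    (hT' : ContDiffOn ℝ ∞ T.symm T.target) {z : JetSpace m} (hz : z ∈ regularSet T) :
    totalJacobian T.symm (prolongMap T z) = (totalJacobian T z)⁻¹ := by
  have hreg := regularOn_regularSet hT
  ext j l
  have h1 : IsSmoothAt (fun y => (T.symm y.base).1 l) (prolongMap T z) :=
    isSmoothAt_fst_base (eventually_contDiffAt T.open_target hT' (base_prolongMap_mem hz)) l
  refine (hreg.newTotalDeriv_comp hz h1 j).symm.trans ?_
  have h2 : (fun z => (T.symm (prolongMap T z).base).1 l) =ᶠ[𝓝 z] fun z => z.1 l := by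
    filter_upwards [hreg.isOpen.mem_nhds hz] with y hy
    rw [prolongMap_base, T.left_inv hy.1]
    rfl
  rw [newTotalDeriv_congr h2]
  simp [newTotalDeriv, totalDeriv_eq, lineDeriv_fst_apply, totalDirection, Pi.single_apply]

lemma prolongMap_mem_regularSet_symm (hT : ContDiffOn ℝ ∞ T T.source)
    (hT' : ContDiffOn ℝ ∞ T.symm T.target) {z : JetSpace m} (hz : z ∈ regularSet T) :
    prolongMap T z ∈ regularSet T.symm := by
  refine ⟨base_prolongMap_mem hz, ?_⟩
  rw [totalJacobian_symm_prolongMap hT hT' hz]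
  exact Matrix.isUnit_nonsing_inv_det _ hz.2

lemma newTotalDeriv_symm_prolongMap (hT : ContDiffOn ℝ ∞ T T.source)
    (hT' : ContDiffOn ℝ ∞ T.symm T.target) {z : JetSpace m} (hz : z ∈ regularSet T)
    {F : JetSpace m → ℝ} (hF : IsSmoothAt F (prolongMap T z)) (l : Fin m) :
    newTotalDeriv T.symm l F (prolongMap T z) = totalDeriv l (fun z => F (prolongMap T z)) z := by
  have hreg := regularOn_regularSet hT
  rw [hreg.totalDeriv_eq_sum hz]
  unfold newTotalDeriv
  rw [totalJacobian_symm_prolongMap hT hT' hz, Matrix.nonsing_inv_nonsing_inv _ hz.2]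
  refine Finset.sum_congr rfl fun j _ => ?_
  rw [← hreg.newTotalDeriv_comp hz hF]
  rfl

/-- Pulled back along the prolongation of `T`, the new total derivatives of `T.symm` become the
ordinary `D_l`, and its `u` components become the coordinates `u^a`. Iterating gives `D^J u^a =
u^a_J`. -/
lemma prolongMap_symm_prolongMap (hT : ContDiffOn ℝ ∞ T T.source)
    (hT' : ContDiffOn ℝ ∞ T.symm T.target) {z : JetSpace m} (hz : z ∈ regularSet T) :
    prolongMap T.symm (prolongMap T z) = z := by
  have hreg := regularOn_regularSet hT
  have hreg' : RegularOn T.symm (regularSet T.symm) := regularOn_regularSet (T := T.symm) hT'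
  refine Prod.ext ?_ (funext fun a => funext fun J => ?_)
  · change (T.symm (prolongMap T z).base).1 = z.1
    rw [prolongMap_base, T.left_inv hz.1]
    rfl
  · have h1 := multiPow_rel (D := newTotalDeriv T.symm) (D' := totalDeriv)
      (R := fun F G => SmoothOn F (regularSet T.symm) ∧
        Set.EqOn (fun z => F (prolongMap T z)) G (regularSet T))
      (fun i F G hFG => ⟨hreg'.smoothOn_newTotalDeriv i F hFG.1, fun y hy =>
        (newTotalDeriv_symm_prolongMap hT hT' hy
          (hFG.1 _ (prolongMap_mem_regularSet_symm hT hT' hy)) i).trans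
          (totalDeriv_congr_on hreg.isOpen hFG.2 i hy)⟩) J
      (F := fun y => (T.symm y.base).2 a) (G := fun y => y.2 a 0)
      ⟨fun y hy => isSmoothAt_snd_base (hreg'.smooth y hy) a, fun y hy => by
        change (T.symm (prolongMap T y).base).2 a = y.2 a 0
        rw [prolongMap_base, T.left_inv hy.1]
        rfl⟩
    have h2 := h1.2 hz
    rw [multiPow_totalDeriv_coord] at h2
    exact h2

/-! ### Naturality of the prolongation of vector fields -/

lemma lineDeriv_comp_base {E : Type*} [NormedAddCommGroup E] [NormedSpace ℝ E]
    {φ : BaseSpace m → E} {z : JetSpace m} (hφ : DifferentiableAt ℝ φ z.base) (V : JetSpace m) :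
    lineDeriv ℝ (fun y => φ y.base) z V = fderiv ℝ φ z.base V.base := by
  have h1 : lineDeriv ℝ (fun y : JetSpace m => y.base) z V = V.base := by
    refine HasLineDerivAt.lineDeriv ?_
    have := ((hasDerivAt_id (0 : ℝ)).smul_const V.base).const_add z.base
    simp only [one_smul] at this
    exact this
  rw [lineDeriv_comp_left (isSmoothAt_base z) hφ, h1]

section Vertical

variable {w : BaseSpace m → BaseSpace m} {W : Set (JetSpace m)}

lemma characteristic_of_vertical (hw0 : ∀ b, (w b).1 = 0) (a : Fin 2) :
    characteristic w a = fun z => (w z.base).2 a := by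
  funext z
  simp [characteristic, hw0]

lemma prolongField_of_vertical (hw0 : ∀ b, (w b).1 = 0) (z : JetSpace m) :
    prolongField w z = (0, fun a J => multiPow totalDeriv J (fun z => (w z.base).2 a) z) := by
  simp [prolongField, hw0, characteristic_of_vertical hw0]

lemma prolongField_base (w : BaseSpace m → BaseSpace m) (z : JetSpace m) :
    (prolongField w z).base = w z.base := by
  unfold prolongField base
  simp [multiPow_zero, characteristic, base]

lemma smoothOn_multiPow_totalDeriv {F : JetSpace m → ℝ} (hF : SmoothOn F W) (J : Fin m → ℕ) :
    SmoothOn (multiPow totalDeriv J F) W :=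
  multiPow_rel (D := totalDeriv) (D' := totalDeriv) (R := fun F _ => SmoothOn F W)
    (fun l _ _ hF z hz => (hF z hz).totalDeriv l) J (G := F) hF

lemma isSmoothMapAt_prolongField_of_vertical (hw0 : ∀ b, (w b).1 = 0)
    (hw : ∀ z ∈ W, ∀ᶠ b in 𝓝 z.base, ContDiffAt ℝ ∞ w b) {z : JetSpace m} (hz : z ∈ W) :
    IsSmoothMapAt (prolongField w) z := by
  rw [show prolongField w = _ from funext fun z => prolongField_of_vertical hw0 z]
  exact ⟨fun _ => isSmoothAt_const _ z, fun a J =>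
    smoothOn_multiPow_totalDeriv (fun y hy => isSmoothAt_snd_base (hw y hy) a) J z hz⟩

/-- Evolutionary vector fields commute with total derivatives. -/
lemma lineDeriv_prolongField_totalDeriv (hW : IsOpen W) (hw0 : ∀ b, (w b).1 = 0)
    (hw : ∀ z ∈ W, ∀ᶠ b in 𝓝 z.base, ContDiffAt ℝ ∞ w b) {z : JetSpace m} (hz : z ∈ W)
    {F : JetSpace m → ℝ} (hF : IsSmoothAt F z) (j : Fin m) :
    lineDeriv ℝ (totalDeriv j F) z (prolongField w z)
      = totalDeriv j (fun y => lineDeriv ℝ F y (prolongField w y)) z := by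
  rw [← sub_eq_zero]
  have h := lineDeriv_lineDeriv_sub hF (isSmoothMapAt_prolongField_of_vertical hw0 hw hz)
    (isSmoothMapAt_totalDirection j z)
  refine h.trans ?_
  have h0 : pushDirection (totalDirection j) z (prolongField w z)
      - pushDirection (prolongField w) z (totalDirection j z) = 0 := by
    rw [sub_eq_zero]
    refine Prod.ext (funext fun l => ?_) (funext fun a => funext fun J => ?_)
    · simp [pushDirection, totalDirection, lineDeriv, prolongField_of_vertical hw0]
    · simp only [pushDirection, totalDirection, lineDeriv_coord]
      simp only [prolongField_of_vertical hw0]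
      exact (apply_multiPow (D := totalDeriv) (W := W)
        (fun i F hF z hz => (hF z hz).totalDeriv i)
        (fun i F G hFG => totalDeriv_congr_on hW hFG i)
        (fun i j F hF z hz => totalDeriv_comm (hF z hz) i j) j J
        (fun y hy => isSmoothAt_snd_base (hw y hy) a) hz).symm
  rw [h0]
  exact hF.differential.map_zero

end Vertical

variable {S v w : BaseSpace m → BaseSpace m} {W : Set (JetSpace m)}

/-- The canonical form, in new variables, of an evolutionary vector field. -/
noncomputable def canonicalDeriv (S w : BaseSpace m → BaseSpace m) (F : JetSpace m → ℝ)
    (z : JetSpace m) : ℝ :=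
  lineDeriv ℝ F z (prolongField w z) - ∑ i,
    lineDeriv ℝ (fun y => (S y.base).1 i) z (prolongField w z) * newTotalDeriv S i F z

/-- Write `X` for the prolongation of `w`. It commutes with every `D_j`, which forces `X D̄_k - D̄_k
X = -∑_i D̄_k (X X̄^i) D̄_i`. Subtracting the horizontal part `∑_i (X X̄^i) D̄_i` from `X` removes
exactly this commutator. -/
lemma RegularOn.canonicalDeriv_newTotalDeriv (h : RegularOn S W) (hw0 : ∀ b, (w b).1 = 0)
    (hw : ∀ z ∈ W, ∀ᶠ b in 𝓝 z.base, ContDiffAt ℝ ∞ w b) {F : JetSpace m → ℝ}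
    (hF : SmoothOn F W) (l : Fin m) {z : JetSpace m} (hz : z ∈ W) :
    canonicalDeriv S w (newTotalDeriv S l F) z = newTotalDeriv S l (canonicalDeriv S w F) z := by
  have hX : IsSmoothMapAt (prolongField w) z := isSmoothMapAt_prolongField_of_vertical hw0 hw hz
  have hS : ∀ i, IsSmoothAt (fun y => (S y.base).1 i) z := isSmoothAt_fst_base (h.smooth z hz)
  have hXF : IsSmoothAt (fun y => lineDeriv ℝ F y (prolongField w y)) z := (hF z hz).lineDeriv hX
  have hXS : ∀ i, IsSmoothAt
      (fun y => lineDeriv ℝ (fun y => (S y.base).1 i) y (prolongField w y)) z :=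
    fun i => (hS i).lineDeriv hX
  have hD : ∀ i, IsSmoothAt (newTotalDeriv S i F) z := fun i =>
    h.smoothOn_newTotalDeriv i F hF z hz
  have hprod : ∀ i, IsSmoothAt (fun y =>
      lineDeriv ℝ (fun y => (S y.base).1 i) y (prolongField w y) * newTotalDeriv S i F y) z :=
    fun i => (hXS i).mul (hD i)
  -- the commutator of the vector field with a new total derivative
  have hbr : (fun k => lineDeriv ℝ (newTotalDeriv S k F) z (prolongField w z)
      + ∑ i, newTotalDeriv S k
          (fun y => lineDeriv ℝ (fun y => (S y.base).1 i) y (prolongField w y)) z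
        * newTotalDeriv S i F z)
      = fun k => newTotalDeriv S k (fun y => lineDeriv ℝ F y (prolongField w y)) z := by
    refine h.cancel hz fun j => ?_
    rw [← h.totalDeriv_eq_sum hz,
      ← lineDeriv_prolongField_totalDeriv h.isOpen hw0 hw hz (hF z hz) j,
      h.lineDeriv_totalDeriv hz hF j]
    simp only [mul_add, Finset.sum_add_distrib, Finset.mul_sum]
    rw [add_comm]
    refine congrArg₂ (· + ·) ?_ rfl
    rw [Finset.sum_comm]
    refine Finset.sum_congr rfl fun i _ => ?_
    have h1 : lineDeriv ℝ (fun z => totalJacobian S z j i) z (prolongField w z)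
        = totalDeriv j (fun y => lineDeriv ℝ (fun y => (S y.base).1 i) y (prolongField w y)) z :=
      lineDeriv_prolongField_totalDeriv h.isOpen hw0 hw hz (hS i) j
    rw [h1, h.totalDeriv_eq_sum hz, Finset.sum_mul]
    exact Finset.sum_congr rfl fun k _ => by ring
  have hcE : IsSmoothAt (canonicalDeriv S w F) z := hXF.sub (IsSmoothAt.sum hprod)
  rw [newTotalDeriv_eq hcE]
  unfold canonicalDeriv
  rw [lineDeriv_sub hXF (IsSmoothAt.sum hprod), lineDeriv_sum hprod]
  simp only [lineDeriv_mul (hXS _) (hD _)]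
  simp only [← newTotalDeriv_eq hXF, ← newTotalDeriv_eq (hXS _), ← newTotalDeriv_eq (hD _)]
  rw [← congrFun hbr l, Finset.sum_add_distrib]
  simp only [fun i => h.newTotalDeriv_comm l i F hF hz]
  ring

/-- The prolongation of a vector field is natural with respect to point transformations: if `S`
maps the vertical field `w` to `v`, then the prolongation of `S` maps the prolongation of `w` to
the prolongation of `v`. -/
theorem RegularOn.pushDirection_prolongField (h : RegularOn S W) (hw0 : ∀ b, (w b).1 = 0)
    (hw : ∀ z ∈ W, ∀ᶠ b in 𝓝 z.base, ContDiffAt ℝ ∞ w b)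
    (hv : ∀ z ∈ W, ∀ᶠ b in 𝓝 (S z.base), ContDiffAt ℝ ∞ v b)
    (hvw : ∀ z ∈ W, v (S z.base) = fderiv ℝ S z.base (w z.base)) {z : JetSpace m} (hz : z ∈ W) :
    pushDirection (prolongMap S) z (prolongField w z) = prolongField v (prolongMap S z) := by
  have hSd : ∀ y ∈ W, DifferentiableAt ℝ S y.base := fun y hy =>
    (h.smooth y hy).self_of_nhds.differentiableAt (by simp)
  have hfst : ∀ y ∈ W, ∀ i, lineDeriv ℝ (fun y => (S y.base).1 i) y (prolongField w y)
      = (v (S y.base)).1 i := by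
    intro y hy i
    have h1 : HasFDerivAt (fun b => (S b).1 i)
        ((ContinuousLinearMap.proj i).comp ((ContinuousLinearMap.fst ℝ _ _).comp
          (fderiv ℝ S y.base))) y.base :=
      (hasFDerivAt_pi'.1 (hSd y hy).hasFDerivAt.fst) i
    rw [lineDeriv_comp_base h1.differentiableAt, h1.fderiv, hvw y hy, prolongField_base]
    rfl
  have hsnd : ∀ y ∈ W, ∀ a, lineDeriv ℝ (fun y => (S y.base).2 a) y (prolongField w y)
      = (v (S y.base)).2 a := by
    intro y hy a
    have h1 : HasFDerivAt (fun b => (S b).2 a)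
        ((ContinuousLinearMap.proj a).comp ((ContinuousLinearMap.snd ℝ _ _).comp
          (fderiv ℝ S y.base))) y.base :=
      (hasFDerivAt_pi'.1 (hSd y hy).hasFDerivAt.snd) a
    rw [lineDeriv_comp_base h1.differentiableAt, h1.fderiv, hvw y hy, prolongField_base]
    rfl
  have hU : ∀ a, SmoothOn (fun y => (S y.base).2 a) W := fun a y hy =>
    isSmoothAt_snd_base (h.smooth y hy) a
  refine Prod.ext (funext fun i => ?_) (funext fun a => funext fun J => ?_)
  · change lineDeriv ℝ (fun y => (S y.base).1 i) z (prolongField w z)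
      = (v (prolongMap S z).base).1 i
    rw [hfst z hz, prolongMap_base]
  · -- the two sides as iterated derivatives of the characteristic
    set W' : Set (JetSpace m) := {y | ∀ᶠ b in 𝓝 y.base, ContDiffAt ℝ ∞ v b} with hW'
    have hmaps : ∀ y ∈ W, prolongMap S y ∈ W' := fun y hy => by
      change ∀ᶠ b in 𝓝 (prolongMap S y).base, _
      rw [prolongMap_base]
      exact hv y hy
    have hQ : SmoothOn (characteristic v a) W' := fun y hy =>
      (isSmoothAt_snd_base hy a).sub (IsSmoothAt.sum fun i =>
        (isSmoothAt_fst_base hy i).mul (isSmoothAt_coord a _ y))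
    -- On the new dependent variable itself the canonical derivative is `η^a - ξ^i ū^a_i`, the
    -- characteristic of `v` at the image jet. Commutation then gives `D_J` of it on `ū^a_J`.
    have hE0 : Set.EqOn (canonicalDeriv S w fun y => (S y.base).2 a)
        (fun y => characteristic v a (prolongMap S y)) W := by
      intro y hy
      simp only [canonicalDeriv, characteristic, hsnd y hy, hfst y hy, prolongMap_base]
      congr 1
      refine Finset.sum_congr rfl fun i _ => ?_
      have h1 := h.prolongMap_add_single hy a 0 i
      rw [zero_add] at h1
      rw [h1]
      congr 1
      refine newTotalDeriv_congr (Filter.Eventually.of_forall fun x => ?_) i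
      exact (congrFun (multiPow_zero (newTotalDeriv S) fun y => (S y.base).2 a) x).symm
    have h1 := multiPow_rel (D := newTotalDeriv S) (D' := newTotalDeriv S)
      (R := fun F G => SmoothOn F W ∧ Set.EqOn (canonicalDeriv S w F) G W)
      (fun i F G hFG => ⟨h.smoothOn_newTotalDeriv i F hFG.1, fun y hy =>
        (h.canonicalDeriv_newTotalDeriv hw0 hw hFG.1 i hy).trans
          (h.newTotalDeriv_congr_on i _ _ hFG.2 hy)⟩) J
      (F := fun y => (S y.base).2 a) (G := fun y => characteristic v a (prolongMap S y))
      ⟨hU a, hE0⟩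
    have h2 := multiPow_rel (D := totalDeriv) (D' := newTotalDeriv S)
      (R := fun F G => SmoothOn F W' ∧ Set.EqOn (fun y => F (prolongMap S y)) G W)
      (fun i F G hFG => ⟨fun y hy => (hFG.1 y hy).totalDeriv i, fun y hy =>
        (h.newTotalDeriv_comp hy (hFG.1 _ (hmaps y hy)) i).symm.trans
          (h.newTotalDeriv_congr_on i _ _ hFG.2 hy)⟩) J
      (F := characteristic v a) (G := fun y => characteristic v a (prolongMap S y))
      ⟨hQ, fun _ _ => rfl⟩
    have h3 := (h1.2 hz).trans (h2.2 hz).symm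
    -- Returning the horizontal part restores the term `ξ^i ū^a_{J + e_i}` of the prolongation
    -- formula.
    rw [canonicalDeriv, sub_eq_iff_eq_add] at h3
    refine h3.trans ?_
    refine congrArg₂ (· + ·) rfl (Finset.sum_congr rfl fun i _ => ?_)
    rw [hfst z hz, prolongMap_base, h.prolongMap_add_single hz]
    rfl

end Naturality

section Vertical

open JetSpace

variable {m : ℕ}

/-! ### Derivatives in vertical directions -/

/-- The derivative of a differential function in a direction which involves only the derivatives
of `u²`. -/
lemma exists_lineDeriv_eq_sum_partialJet {f : JetSpace m → ℝ} {z : JetSpace m}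
    (hf : IsSmoothAt f z) : ∃ K, ∀ v : JetSpace m, v.1 = 0 → v.2 0 = 0 →
      lineDeriv ℝ f z v = ∑ J : MultiIdx m K, v.2 1 J.1 * partialJet 1 J.1 f z := by
  obtain ⟨K, g, hg, hfg⟩ := hf
  have hL : ∀ v, lineDeriv ℝ f z v = fderiv ℝ g (z.trunc K) (v.trunc K) := fun v =>
    (hasLineDerivAt_of_eventuallyEq_trunc (hg.self_of_nhds.differentiableAt (by simp))
      hfg v).lineDeriv
  refine ⟨K, fun v h1 h2 => ?_⟩
  have hv : v.trunc K = ∑ J : MultiIdx m K, v.2 1 J.1 •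
      trunc K ((0, Pi.single 1 (Pi.single J.1 1)) : JetSpace m) := by
    refine Prod.ext ?_ (funext fun a => funext fun I => ?_)
    · rw [Prod.fst_sum]
      simp [trunc, h1]
    · rw [Prod.snd_sum, Finset.sum_apply, Finset.sum_apply]
      fin_cases a
      · simp [trunc, h2]
      · rw [Finset.sum_eq_single I]
        · simp [trunc]
        · intro J _ hJ
          have : I.1 ≠ J.1 := fun h => hJ (Subtype.ext h.symm)
          simp [trunc, Pi.single_eq_of_ne this]
        · simp
  rw [hL, hv, map_sum]
  refine Finset.sum_congr rfl fun J _ => ?_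
  rw [map_smul, partialJet, hL]
  rfl

/-- A finite linear combination of monomials which vanishes identically is trivial. -/
lemma eq_zero_of_sum_monomials_eq_zero {K : ℕ} {c : MultiIdx m K → ℝ}
    (h : ∀ t : Fin m → ℝ, ∑ J : MultiIdx m K, (∏ i, t i ^ J.1 i) * c J = 0) (J : MultiIdx m K) :
    c J = 0 := by
  set p : MvPolynomial (Fin m) ℝ :=
    ∑ J : MultiIdx m K, MvPolynomial.monomial (Finsupp.equivFunOnFinite.symm J.1) (c J) with hp
  have hp0 : p = 0 := by
    refine MvPolynomial.funext fun t => ?_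
    rw [hp, map_sum, map_zero, ← h t]
    refine Finset.sum_congr rfl fun J _ => ?_
    rw [MvPolynomial.eval_monomial, mul_comm, Finsupp.prod_fintype _ _ (fun i => by simp)]
    rfl
  have h1 := congrArg (MvPolynomial.coeff (Finsupp.equivFunOnFinite.symm J.1)) hp0
  rw [hp, MvPolynomial.coeff_sum, MvPolynomial.coeff_zero, Finset.sum_eq_single J] at h1
  · simpa using h1
  · intro I _ hI
    rw [MvPolynomial.coeff_monomial, if_neg]
    exact fun h => hI (Subtype.ext (Finsupp.equivFunOnFinite.symm.injective h))
  · simp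

/-- The exponential `exp (∑ t_i x_i)` as a function on the space of the variables. -/
noncomputable def expX (t : Fin m → ℝ) (b : BaseSpace m) : ℝ := Real.exp (∑ i, t i * b.1 i)

lemma contDiff_expX (t : Fin m → ℝ) : ContDiff ℝ ∞ (expX t) := by
  unfold expX
  fun_prop

/-- Exponentials are joint eigenfunctions of the total derivatives. The eigenvalue `t^J` of `D^J`
separates the multi-indices at a single jet as `t` varies. -/
lemma totalDeriv_expX (t : Fin m → ℝ) (i : Fin m) (z : JetSpace m) :
    totalDeriv i (fun z => expX t z.base) z = t i * expX t z.base := by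
  have hL : HasFDerivAt (fun b : BaseSpace m => ∑ i, t i * b.1 i)
      (∑ i, t i • (ContinuousLinearMap.proj (R := ℝ) (φ := fun _ : Fin m => ℝ) i).comp
        (ContinuousLinearMap.fst ℝ (Fin m → ℝ) (Fin 2 → ℝ))) z.base := by
    refine HasFDerivAt.fun_sum fun i _ => HasFDerivAt.const_mul ?_ (t i)
    exact ContinuousLinearMap.hasFDerivAt
      ((ContinuousLinearMap.proj (R := ℝ) (φ := fun _ : Fin m => ℝ) i).comp
        (ContinuousLinearMap.fst ℝ (Fin m → ℝ) (Fin 2 → ℝ)))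
  have h1 : HasFDerivAt (expX t) _ z.base := hL.exp
  rw [totalDeriv_eq, lineDeriv_comp_base h1.differentiableAt, h1.fderiv]
  simp only [smul_apply, sum_apply, ContinuousLinearMap.comp_apply, ContinuousLinearMap.proj_apply,
    ContinuousLinearMap.coe_fst', smul_eq_mul, totalDirection, base]
  have h2 : ∑ j, t j * (Pi.single i 1 : Fin m → ℝ) j = t i := by simp [Pi.single_apply]
  rw [h2, mul_comm]
  rfl

lemma multiPow_totalDeriv_expX (t : Fin m → ℝ) (J : Fin m → ℕ) (z : JetSpace m) :
    multiPow totalDeriv J (fun z => expX t z.base) z = (∏ i, t i ^ J i) * expX t z.base := by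
  have key : ∀ l : List (Fin m), l.foldr (fun i H => (totalDeriv i)^[J i] H)
      (fun z : JetSpace m => expX t z.base)
        = fun z => (l.map fun i => t i ^ J i).prod * expX t z.base := by
    intro l
    induction l with
    | nil => simp
    | cons i l ih =>
      rw [List.foldr_cons, ih, List.map_cons, List.prod_cons]
      generalize (l.map fun i => t i ^ J i).prod = s
      generalize J i = n
      induction n with
      | zero => simp
      | succ n ihn =>
        rw [Function.iterate_succ_apply', ihn]
        funext y
        have h1 : totalDeriv i (fun z : JetSpace m => t i ^ n * s * expX t z.base) y
            = t i ^ n * s * totalDeriv i (fun z => expX t z.base) y :=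
          deriv_const_mul_field _
        rw [h1, totalDeriv_expX]
        ring
  unfold multiPow
  rw [key, ← List.ofFn_eq_map, List.prod_ofFn]

/-! ### The action of prolonged vector fields in rectified coordinates -/

/-- The vector field `c ∂/∂u²`. -/
def verticalField (c : BaseSpace m → ℝ) (b : BaseSpace m) : BaseSpace m :=
  (0, Pi.single 1 (c b))

lemma verticalField_eq_smul (c : BaseSpace m → ℝ) (b : BaseSpace m) :
    verticalField c b = c b • ((0, Pi.single 1 1) : BaseSpace m) := by
  simp [verticalField, Prod.smul_mk, ← Pi.single_smul]

lemma prolongField_verticalField_fst (c : BaseSpace m → ℝ) (z : JetSpace m) :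
    (prolongField (verticalField c) z).1 = 0 := rfl

lemma prolongField_verticalField_snd_zero (c : BaseSpace m → ℝ) (z : JetSpace m) :
    (prolongField (verticalField c) z).2 0 = 0 := by
  rw [prolongField_of_vertical fun _ => rfl]
  have h1 : (fun z : JetSpace m => (verticalField c z.base).2 0) = fun _ => 0 := by
    funext z
    simp [verticalField]
  funext J
  have h2 := multiPow_rel (D := totalDeriv (m := m)) (D' := totalDeriv (m := m))
    (R := fun F _ => F = fun _ => 0)
    (fun i F _ hF => by
      subst hF
      funext z
      simp [totalDeriv, lineDeriv]) J (F := fun _ => 0) (G := fun _ => 0) rfl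
  simp only [h1]
  rw [h2]
  rfl

lemma prolongField_verticalField_snd_one (c : BaseSpace m → ℝ) (z : JetSpace m)
    (J : Fin m → ℕ) : (prolongField (verticalField c) z).2 1 J
      = multiPow totalDeriv J (fun z => c z.base) z := by
  rw [prolongField_of_vertical fun _ => rfl]
  simp [verticalField]

/-- The action of a vector field in rectified coordinates. -/
lemma RegularOn.applyField_prolongMap {S v : BaseSpace m → BaseSpace m} {W : Set (JetSpace m)}
    (h : RegularOn S W) {c : BaseSpace m → ℝ}
    (hc : ∀ z ∈ W, ∀ᶠ b in 𝓝 z.base, ContDiffAt ℝ ∞ c b)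
    (hv : ∀ z ∈ W, ∀ᶠ b in 𝓝 (S z.base), ContDiffAt ℝ ∞ v b)
    (hvc : ∀ z ∈ W, v (S z.base) = c z.base • fderiv ℝ S z.base (0, Pi.single 1 1))
    {z : JetSpace m} (hz : z ∈ W) {G : JetSpace m → ℝ} (hG : IsSmoothAt G (prolongMap S z)) :
    applyField v G (prolongMap S z)
      = lineDeriv ℝ (fun y => G (prolongMap S y)) z (prolongField (verticalField c) z) := by
  rw [applyField, lineDeriv_comp hG (h.isSmoothMapAt_prolongMap hz),
    h.pushDirection_prolongField (v := v) (fun _ => rfl) ?_ hv ?_ hz]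
  · intro y hy
    filter_upwards [hc y hy] with b hb
    refine contDiffAt_const.prodMk (contDiffAt_pi.2 fun a => ?_)
    by_cases ha : a = 1
    · subst ha; simpa using hb
    · simpa [Pi.single_eq_of_ne ha] using contDiffAt_const
  · intro y hy
    rw [hvc y hy, verticalField_eq_smul, map_smul]

lemma RegularOn.mono {S : BaseSpace m → BaseSpace m} {W W' : Set (JetSpace m)}
    (h : RegularOn S W) (hW : W' ⊆ W) (hW' : IsOpen W') : RegularOn S W' :=
  ⟨hW', fun z hz => h.smooth z (hW hz), fun z hz => h.isUnit z (hW hz)⟩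

/-- A linear isomorphism adapted to a jet and a vector which is transverse to it. -/
lemma exists_adapted_frame (z : JetSpace m) (b : BaseSpace m)
    (hb : ∃ a, b.2 a - ∑ i, b.1 i * z.2 a (Pi.single i 1) ≠ 0) :
    ∃ M : BaseSpace m ≃L[ℝ] BaseSpace m,
      (∀ j, M (Pi.single j 1, 0) = (totalDirection j z).base) ∧ M (0, Pi.single 1 1) = b := by
  set Q : Fin 2 → ℝ := fun a => b.2 a - ∑ i, b.1 i * z.2 a (Pi.single i 1) with hQ
  -- `w` is the characteristic `Q` rotated by a right angle, the image chosen for `∂/∂u¹`. Modulo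
  -- the directions `(e_j, u_j)` the vector `b` is `(0, Q)`, so injectivity reduces to the
  -- determinant `Q 0 ^ 2 + Q 1 ^ 2` being nonzero.
  set w : Fin 2 → ℝ := ![-Q 1, Q 0] with hw
  let M₀ : BaseSpace m →ₗ[ℝ] BaseSpace m :=
    { toFun := fun p => (p.1 + p.2 1 • b.1,
        fun a => ∑ j, p.1 j * z.2 a (Pi.single j 1) + p.2 1 * b.2 a + p.2 0 * w a)
      map_add' := fun p q => by
        refine Prod.ext ?_ (funext fun a => ?_)
        · simp only [Prod.fst_add, Prod.snd_add, Pi.add_apply, add_smul]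
          abel
        · simp only [Prod.fst_add, Prod.snd_add, Pi.add_apply, add_mul, Finset.sum_add_distrib]
          ring
      map_smul' := fun c p => by
        refine Prod.ext ?_ (funext fun a => ?_)
        · simp [mul_smul]
        · simp only [Prod.smul_fst, Prod.smul_snd, Pi.smul_apply, smul_eq_mul, RingHom.id_apply,
            mul_add, Finset.mul_sum, mul_assoc] }
  have hinj : Function.Injective M₀ := by
    refine (injective_iff_map_eq_zero M₀).2 fun p hp => ?_
    have h1 : ∀ j, p.1 j = -(p.2 1 * b.1 j) := fun j => by
      have : p.1 j + p.2 1 * b.1 j = 0 := congrFun (congrArg Prod.fst hp) j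
      linarith
    have h2 : ∀ a, p.2 1 * Q a + p.2 0 * w a = 0 := fun a => by
      have h3 : ∑ j, p.1 j * z.2 a (Pi.single j 1) + p.2 1 * b.2 a + p.2 0 * w a = 0 :=
        congrFun (congrArg Prod.snd hp) a
      simp only [h1, neg_mul, Finset.sum_neg_distrib, mul_assoc] at h3
      rw [← Finset.mul_sum] at h3
      rw [← h3]
      simp only [hQ]
      ring
    have h3 : p.2 1 * Q 0 - p.2 0 * Q 1 = 0 := by
      have := h2 0
      simp only [hw, Matrix.cons_val_zero] at this
      linarith
    have h4 : p.2 1 * Q 1 + p.2 0 * Q 0 = 0 := by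
      have := h2 1
      simpa [hw] using this
    have h5 : Q 0 ^ 2 + Q 1 ^ 2 ≠ 0 := by
      obtain ⟨a, ha⟩ := hb
      change Q a ≠ 0 at ha
      fin_cases a
      · have : 0 < Q 0 ^ 2 := by positivity
        positivity
      · have : 0 < Q 1 ^ 2 := by positivity
        positivity
    have h6 : p.2 1 = 0 := by
      have : p.2 1 * (Q 0 ^ 2 + Q 1 ^ 2) = 0 := by linear_combination Q 0 * h3 + Q 1 * h4
      exact (mul_eq_zero.1 this).resolve_right h5
    have h7 : p.2 0 = 0 := by
      have : p.2 0 * (Q 0 ^ 2 + Q 1 ^ 2) = 0 := by linear_combination Q 0 * h4 - Q 1 * h3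
      exact (mul_eq_zero.1 this).resolve_right h5
    refine Prod.ext (funext fun j => ?_) (funext fun a => ?_)
    · simp [h1, h6]
    · fin_cases a
      · exact h7
      · exact h6
  refine ⟨(LinearEquiv.ofInjectiveEndo M₀ hinj).toContinuousLinearEquiv, fun j => ?_, ?_⟩
  · change M₀ (Pi.single j 1, 0) = _
    refine Prod.ext (funext fun i => ?_) (funext fun a => ?_)
    · simp [M₀, totalDirection, base]
    · simp [M₀, totalDirection, base, Pi.single_apply]
  · change M₀ (0, Pi.single 1 1) = b
    refine Prod.ext (funext fun i => ?_) (funext fun a => ?_)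
    · simp [M₀]
    · simp [M₀]

end Vertical

/-! ### The two implications and the theorem -/

section Main

open JetSpace

variable {m k : ℕ}

lemma contDiffOn_subsystem {Ω : Set (Jet m k)} {Δ β : Fin 2 → Jet m k → ℝ}
    (hΔ : ∀ i, ContDiffOn ℝ ∞ (Δ i) Ω) (hβ : ∀ i, ContDiffOn ℝ ∞ (β i) Ω) :
    ContDiffOn ℝ ∞ (subsystem β Δ) Ω :=
  ContDiffOn.sum fun i _ => (hβ i).mul (hΔ i)

lemma contDiffOn_fderiv_symm_apply {T : OpenPartialHomeomorph (BaseSpace m) (BaseSpace m)}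
    (hT : ContDiffOn ℝ ∞ T T.source) (hT' : ContDiffOn ℝ ∞ T.symm T.target) (e : BaseSpace m) :
    ContDiffOn ℝ ∞ (fun b => fderiv ℝ T.symm (T b) e) T.source :=
  ((hT'.fderiv_of_isOpen T.open_target (m := ∞) le_rfl).comp hT fun _ hx =>
    T.map_source hx).clm_apply contDiffOn_const

lemma fderiv_fderiv_symm {T : OpenPartialHomeomorph (BaseSpace m) (BaseSpace m)}
    (hT : ContDiffOn ℝ ∞ T T.source) (hT' : ContDiffOn ℝ ∞ T.symm T.target) {b : BaseSpace m}
    (hb : b ∈ T.source) (e : BaseSpace m) :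
    fderiv ℝ T b (fderiv ℝ T.symm (T b) e) = e := by
  have hTb := T.map_source hb
  have h1 : DifferentiableAt ℝ T.symm (T b) :=
    (hT'.contDiffAt (T.open_target.mem_nhds hTb)).differentiableAt (by simp)
  have h2 : DifferentiableAt ℝ T (T.symm (T b)) := by
    rw [T.left_inv hb]
    exact (hT.contDiffAt (T.open_source.mem_nhds hb)).differentiableAt (by simp)
  have h3 := (h2.hasFDerivAt.comp (T b) h1.hasFDerivAt).unique
    ((hasFDerivAt_id (T b)).congr_of_eventuallyEq (T.eventually_right_inverse hTb))
  rw [T.left_inv hb] at h3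
  exact DFunLike.congr_fun h3 e

lemma totalJacobian_eq_fderiv {T : BaseSpace m → BaseSpace m} {z : JetSpace m}
    (hT : DifferentiableAt ℝ T z.base) (j l : Fin m) :
    totalJacobian T z j l = (fderiv ℝ T z.base (totalDirection j z).base).1 l := by
  have h1 : HasFDerivAt (fun b => (T b).1 l)
      ((ContinuousLinearMap.proj l).comp ((ContinuousLinearMap.fst ℝ _ _).comp
        (fderiv ℝ T z.base))) z.base :=
    (hasFDerivAt_pi'.1 hT.hasFDerivAt.fst) l
  change lineDeriv ℝ (fun y => (T y.base).1 l) z (totalDirection j z) = _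
  rw [lineDeriv_comp_base h1.differentiableAt, h1.fderiv]
  rfl

/-- The field which is mapped to `∂/∂ū²` has a nonvanishing characteristic. -/
lemma exists_characteristic_ne_zero {T : OpenPartialHomeomorph (BaseSpace m) (BaseSpace m)}
    (hT : ContDiffOn ℝ ∞ T T.source) (hT' : ContDiffOn ℝ ∞ T.symm T.target) {z : JetSpace m}
    (hz : z ∈ regularSet T) :
    ∃ a, characteristic (fun b => fderiv ℝ T.symm (T b) (0, Pi.single 1 1)) a z ≠ 0 := by
  by_contra! hcon
  have hTd : DifferentiableAt ℝ T z.base :=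
    (hT.contDiffAt (T.open_source.mem_nhds hz.1)).differentiableAt (by simp)
  have hv := fderiv_fderiv_symm hT hT' hz.1 (0, Pi.single 1 1)
  set v : BaseSpace m := fderiv ℝ T.symm (T z.base) (0, Pi.single 1 1) with hv_def
  -- A vanishing characteristic says that `v` is tangent, i.e. a combination of the base parts of
  -- the total directions.
  have h1 : v = ∑ i, v.1 i • (totalDirection i z).base := by
    refine Prod.ext (funext fun i => ?_) (funext fun a => ?_)
    · rw [Prod.fst_sum, Finset.sum_apply]
      simp [totalDirection, base, Pi.single_apply]
    · rw [Prod.snd_sum, Finset.sum_apply]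
      have h2 := hcon a
      rw [characteristic, sub_eq_zero] at h2
      refine h2.trans ?_
      refine Finset.sum_congr rfl fun i _ => ?_
      simp [totalDirection, base, hv_def]
  -- The image of `v` under the differential of `T` is `∂/∂ū²`, which has no component along the
  -- independent variables.
  have h3 : Matrix.vecMul v.1 (totalJacobian T z) = 0 := by
    funext l
    have h4 : (fderiv ℝ T z.base v).1 l = 0 := by rw [hv]; rfl
    rw [h1, map_sum, Prod.fst_sum, Finset.sum_apply] at h4
    rw [Matrix.vecMul, dotProduct, Pi.zero_apply, ← h4]
    refine Finset.sum_congr rfl fun j _ => ?_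
    rw [map_smul, totalJacobian_eq_fderiv hTd]
    rfl
  have h5 : v.1 = 0 := by
    have := congrArg (fun x => Matrix.vecMul x (totalJacobian T z)⁻¹) h3
    simpa [Matrix.vecMul_vecMul, Matrix.mul_nonsing_inv _ hz.2] using this
  have h6 : v = 0 := by
    rw [h1]
    simp [h5]
  rw [h6, map_zero] at hv
  have := congrFun (congrArg Prod.snd hv) 1
  simp at this

/-- The field is the pullback of `∂/∂ū²`. A factor `c` becomes `c ∘ T.symm` in the new variables,
and the prolonged field still involves only the `∂/∂ū²_J`. The neighbourhood `V` is fixed before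
`c`, since decoupling controls all these partial derivatives at once. -/
theorem IsDecouplableAt.admitsArbitrarySymmetryAt {G : JetSpace m → ℝ} {z₀ : JetSpace m}
    (hG : IsSmoothAt G z₀) (h : IsDecouplableAt G z₀) : AdmitsArbitrarySymmetryAt G z₀ := by
  obtain ⟨T, hz, hT, hT', hdet, F, hF, hdec⟩ := h
  have hz₀ : z₀ ∈ regularSet T := ⟨hz, hdet⟩
  have hreg := regularOn_regularSet hT
  have hreg' : RegularOn T.symm (regularSet T.symm) := regularOn_regularSet (T := T.symm) hT'
  have hP : ContinuousAt (prolongMap T) z₀ := (hreg.isSmoothMapAt_prolongMap hz₀).continuousAt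
  have hev : ∀ᶠ z in 𝓝 z₀, z ∈ regularSet T ∧ IsSmoothAt G z ∧ IsSmoothAt F (prolongMap T z) ∧
      F (prolongMap T z) ≠ 0 ∧ ∀ I : Fin m → ℕ,
        partialJet 1 I (fun y => F y * G (prolongMap T.symm y)) (prolongMap T z) = 0 := by
    filter_upwards [hreg.isOpen.mem_nhds hz₀, hG.eventually,
      hP.eventually (isDiffFunAt_iff.1 hF).eventually, hP.eventually hdec] with z h1 h2 h3 h4
    exact ⟨h1, h2, h3, h4⟩
  obtain ⟨V, hV, hVo, hzV⟩ := eventually_nhds_iff.1 hev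
  refine ⟨T.source, fun b => fderiv ℝ T.symm (T b) (0, Pi.single 1 1), V, T.open_source,
    contDiffOn_fderiv_symm_apply hT hT' _, hVo, hzV, fun z hz => (hV z hz).1.1,
    exists_characteristic_ne_zero hT hT' hz₀, fun c hc z hzV hGz => ?_⟩
  obtain ⟨hzr, hGs, hFs, hF0, hpart⟩ := hV z hzV
  have hPz := prolongMap_mem_regularSet_symm hT hT' hzr
  have hinv := prolongMap_symm_prolongMap hT hT' hzr
  have hGs' : IsSmoothAt G (prolongMap T.symm (prolongMap T z)) := by rwa [hinv]
  have hGbar : IsSmoothAt (fun y => G (prolongMap T.symm y)) (prolongMap T z) :=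
    hGs'.comp (hreg'.isSmoothMapAt_prolongMap hPz)
  have hcT : ContDiffOn ℝ ∞ (fun b => c (T.symm b)) T.target :=
    hc.comp hT' fun _ hx => T.map_target hx
  have hvs := hc.smul (contDiffOn_fderiv_symm_apply hT hT' (0, Pi.single 1 1))
  have key := hreg'.applyField_prolongMap
    (v := fun b => c b • fderiv ℝ T.symm (T b) (0, Pi.single 1 1)) (c := fun b => c (T.symm b))
    (fun y hy => eventually_contDiffAt T.open_target hcT hy.1)
    (fun y hy => eventually_contDiffAt T.open_source hvs (T.map_target hy.1))
    (fun y hy => by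
      have h1 : T (T.symm y.base) = y.base := T.right_inv hy.1
      simp only [h1]) hPz hGs'
  rw [hinv] at key
  rw [key]
  set X := prolongField (verticalField fun b => c (T.symm b)) (prolongMap T z) with hX
  have hprod : lineDeriv ℝ (fun y => F y * G (prolongMap T.symm y)) (prolongMap T z) X = 0 := by
    obtain ⟨K, hK⟩ := exists_lineDeriv_eq_sum_partialJet (hFs.mul hGbar)
    rw [hK X (prolongField_verticalField_fst _ _) (prolongField_verticalField_snd_zero _ _)]
    exact Finset.sum_eq_zero fun J _ => by rw [hpart, mul_zero]
  rw [lineDeriv_mul hFs hGbar, hinv, hGz, mul_zero, zero_add] at hprod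
  exact (mul_eq_zero.1 hprod).resolve_left hF0

/-- The inclusion of a finite jet into the jets of infinite order, with the remaining coordinates
taken from a given jet. -/
noncomputable def extendJet (K : ℕ) (z : JetSpace m) (p : Jet m K) : JetSpace m :=
  (p.1, fun a J => if h : ∑ i, J i ≤ K then p.2 a ⟨J, h⟩ else z.2 a J)

lemma trunc_extendJet (K : ℕ) (z : JetSpace m) (p : Jet m K) : (extendJet K z p).trunc K = p :=
  Prod.ext rfl (funext fun _ => funext fun J => dif_pos J.2)

lemma extendJet_trunc (K : ℕ) (z : JetSpace m) : extendJet K z (z.trunc K) = z := by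
  refine Prod.ext rfl (funext fun a => funext fun J => ?_)
  simp [extendJet, trunc]

lemma continuous_extendJet (K : ℕ) (z : JetSpace m) : Continuous (extendJet K z) := by
  refine continuous_fst.prodMk (continuous_pi fun a => continuous_pi fun J => ?_)
  by_cases h : ∑ i, J i ≤ K
  · simp only [h, dif_pos]
    fun_prop
  · simp only [h]
    exact continuous_const

/-- The projection of finite jets which forgets `u²`. -/
noncomputable def forgetSnd (m K : ℕ) : Jet m K →L[ℝ] Jet m K :=
  (ContinuousLinearMap.fst ℝ _ _).prod ((ContinuousLinearMap.single ℝ _ 0).comp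
    ((ContinuousLinearMap.proj 0).comp (ContinuousLinearMap.snd ℝ _ _)))

lemma forgetSnd_apply (K : ℕ) (p : Jet m K) : forgetSnd m K p = (p.1, Pi.single 0 (p.2 0)) := rfl

/-- A function which, at its zeros, is stationary in all directions that involve `u²` only is
decoupled up to a factor. -/
theorem isDecoupledAt_of_lineDeriv_eq_zero {G : JetSpace m → ℝ} {z₀ : JetSpace m}
    (hG : IsSmoothAt G z₀) (hrank : G z₀ = 0 → ∃ V, lineDeriv ℝ G z₀ V ≠ 0)
    (hvert : ∀ᶠ z in 𝓝 z₀, G z = 0 → ∀ v : JetSpace m, v.1 = 0 → v.2 0 = 0 →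
      lineDeriv ℝ G z v = 0) : IsDecoupledAt G z₀ := by
  by_cases h0 : G z₀ = 0
  · obtain ⟨K, g, hg, hGg⟩ := hG
    have hg0 : g (z₀.trunc K) = 0 := by rw [← h0, hGg.self_of_nhds]
    have hdg : fderiv ℝ g (z₀.trunc K) ≠ 0 := by
      obtain ⟨V, hV⟩ := hrank h0
      intro hcon
      rw [(hasLineDerivAt_of_eventuallyEq_trunc
        (hg.self_of_nhds.differentiableAt (by simp)) hGg V).lineDeriv, hcon] at hV
      exact hV rfl
    -- Conditions near `z₀` are pulled back to finite jets by filling in the higher coordinates of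
    -- `z₀`; directions are extended by `0`.
    have hext : Filter.Tendsto (extendJet K z₀) (𝓝 (z₀.trunc K)) (𝓝 z₀) := by
      have := (continuous_extendJet K z₀).tendsto (z₀.trunc K)
      rwa [extendJet_trunc] at this
    obtain ⟨F, hF, hFg⟩ := exists_factor_of_fderiv_eq_zero_on_ker (π := forgetSnd m K)
      (fun p => by simp [forgetSnd_apply]) hg hg0 hdg (by
        filter_upwards [hg, hext.eventually hvert, hext.eventually hGg.eventuallyEq_nhds]
          with p h1 h2 h3 h4 n hn
        have hn1 : n.1 = 0 := congrArg Prod.fst hn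
        have hn2 : n.2 0 = 0 := by
          have := congrFun (congrArg Prod.snd hn) 0
          simpa [forgetSnd_apply] using this
        have h5 := h2 (by
          rw [h3.self_of_nhds]
          simp only [trunc_extendJet, h4]) (extendJet K 0 n) hn1 (by
          funext J
          simp [extendJet, hn2])
        have h6 := hasLineDerivAt_of_eventuallyEq_trunc (z := extendJet K z₀ p)
          (by rw [trunc_extendJet]; exact h1.differentiableAt (by simp)) h3 (extendJet K 0 n)
        rw [h6.lineDeriv, trunc_extendJet, trunc_extendJet] at h5
        exact h5)
    refine ⟨fun z => F (z.trunc K), isDiffFunAt_iff.2 (isSmoothAt_comp_trunc hF), ?_⟩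
    have hFz := ((continuous_trunc K).tendsto z₀).eventually hFg.eventually_nhds
    filter_upwards [hFz, hGg.eventuallyEq_nhds] with z h1 h2
    refine ⟨h1.self_of_nhds.1, fun I => ?_⟩
    have h3 : (fun y => F (y.trunc K) * G y) =ᶠ[𝓝 z]
        fun y => g (z₀.trunc K + forgetSnd m K (y.trunc K - z₀.trunc K)) := by
      filter_upwards [(continuous_trunc K).continuousAt.eventually h1, h2] with y h4 h5
      rw [h5, h4.2]
    rw [partialJet, lineDeriv_congr h3, lineDeriv]
    -- After multiplication by `F` the function is `g` with the `u²` coordinates frozen at those of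
    -- `z₀`, so it is constant in every `u²_I` direction.
    have h6 : ∀ t : ℝ, g (z₀.trunc K + forgetSnd m K
        ((z + t • ((0, Pi.single 1 (Pi.single I 1)) : JetSpace m)).trunc K - z₀.trunc K))
        = g (z₀.trunc K + forgetSnd m K (z.trunc K - z₀.trunc K)) := by
      intro t
      have h7 : forgetSnd m K (trunc K ((0, Pi.single 1 (Pi.single I 1)) : JetSpace m)) = 0 := by
        rw [forgetSnd_apply]
        refine Prod.ext rfl ?_
        have : (fun J : MultiIdx m K =>
            (Pi.single 1 (Pi.single I 1) : Fin 2 → (Fin m → ℕ) → ℝ) 0 J.1) = 0 := by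
          funext J
          simp
        simp only [trunc, this, Pi.single_zero]
        rfl
      rw [trunc_add, trunc_smul, add_sub_right_comm, map_add, map_smul, h7, smul_zero, add_zero]
    simp only [h6, deriv_const]
  -- Off the zero set the factor `1 / G` turns the function into the constant `1`.
  · refine ⟨fun z => (G z)⁻¹, isDiffFunAt_iff.2 (hG.inv h0), ?_⟩
    filter_upwards [(hG.continuousAt.eventually_ne h0).eventually_nhds] with z hz
    refine ⟨inv_ne_zero hz.self_of_nhds, fun I => ?_⟩
    have h1 : (fun y => (G y)⁻¹ * G y) =ᶠ[𝓝 z] fun _ => 1 := by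
      filter_upwards [hz] with y hy
      exact inv_mul_cancel₀ hy
    rw [partialJet, lineDeriv_congr h1]
    simp [lineDeriv]

/-- The transformation is the inverse of a flow box `S` for `v`. In these coordinates the arbitrary
factor forces all `u²` partial derivatives to vanish at the zeros of `G`, and maximal rank is
transported by the chain rule. -/
theorem AdmitsArbitrarySymmetryAt.isDecouplableAt {G : JetSpace m → ℝ} {z₀ : JetSpace m}
    (hG : IsSmoothAt G z₀) (hrank : G z₀ = 0 → ∃ V, lineDeriv ℝ G z₀ V ≠ 0)
    (h : AdmitsArbitrarySymmetryAt G z₀) : IsDecouplableAt G z₀ := by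
  obtain ⟨B, v, V, hB, hv, hV, hzV, hVB, hchar, hsymm⟩ := h
  have hbB := hVB z₀ hzV
  have hvs : ∀ᶠ b in 𝓝 z₀.base, ContDiffAt ℝ ∞ v b := eventually_contDiffAt hB hv hbB
  obtain ⟨M, hM, hMe⟩ := exists_adapted_frame z₀ (v z₀.base) hchar
  obtain ⟨S, h0S, hS0, hSB, hS, hS', hSd, hSv⟩ := exists_flow_box hvs
    (ℓ := (ContinuousLinearMap.proj 1).comp (ContinuousLinearMap.snd ℝ (Fin m → ℝ) (Fin 2 → ℝ)))
    (e := (0, Pi.single 1 1)) (by simp) hMe (hB.mem_nhds hbB)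
  have hb : z₀.base ∈ S.target := by rw [← hS0]; exact S.map_source h0S
  have hTd : HasFDerivAt S.symm (M.symm : BaseSpace m →L[ℝ] BaseSpace m) z₀.base := by
    refine S.hasFDerivAt_symm hb ?_
    rwa [← hS0, S.left_inv h0S]
  -- The frame `M` sends `e_j` to the base part of the total direction `D_j` at `z₀`, and `S.symm`
  -- has differential `M.symm` there.
  have hjac : totalJacobian S.symm z₀ = 1 := by
    ext j l
    rw [totalJacobian_eq_fderiv hTd.differentiableAt, hTd.fderiv, ← hM j]
    change (M.symm (M (Pi.single j 1, 0))).1 l = _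
    rw [M.symm_apply_apply, Matrix.one_apply]
    simp only [Pi.single_apply, eq_comm]
  have hz₀ : z₀ ∈ regularSet S.symm := ⟨hb, by rw [hjac]; simp⟩
  have hreg := regularOn_regularSet (T := S) hS
  have hreg' := regularOn_regularSet (T := S.symm) hS'
  have hPz₀ : prolongMap S.symm z₀ ∈ regularSet S :=
    prolongMap_mem_regularSet_symm (T := S.symm) hS' hS hz₀
  have hinv : ∀ z ∈ regularSet S.symm, prolongMap S (prolongMap S.symm z) = z := fun z hz =>
    prolongMap_symm_prolongMap (T := S.symm) hS' hS hz
  have hP := hreg'.isSmoothMapAt_prolongMap hz₀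
  have hP' := hreg.isSmoothMapAt_prolongMap hPz₀
  have hGz₀ : IsSmoothAt G (prolongMap S (prolongMap S.symm z₀)) := by rwa [hinv z₀ hz₀]
  have hGbar : IsSmoothAt (fun z => G (prolongMap S z)) (prolongMap S.symm z₀) := hGz₀.comp hP'
  refine ⟨S.symm, hb, hS', by rwa [OpenPartialHomeomorph.symm_symm], hz₀.2, ?_⟩
  rw [OpenPartialHomeomorph.symm_symm]
  refine isDecoupledAt_of_lineDeriv_eq_zero hGbar ?_ ?_
  · intro h
    rw [hinv z₀ hz₀] at h
    obtain ⟨u, hu⟩ := hrank h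
    refine ⟨pushDirection (prolongMap S.symm) z₀ u, ?_⟩
    rw [← lineDeriv_comp hGbar hP]
    have h1 : (fun z => G (prolongMap S (prolongMap S.symm z))) =ᶠ[𝓝 z₀] G := by
      filter_upwards [hreg'.isOpen.mem_nhds hz₀] with z hz
      rw [hinv z hz]
    rwa [lineDeriv_congr h1]
  · -- a global extension of the rectifying coordinates
    obtain ⟨R, hR, hRS⟩ := exists_contDiff_eventuallyEq
      (eventually_contDiffAt S.open_target hS' hb)
    obtain ⟨N, hN, hNo, hbN⟩ := eventually_nhds_iff.1 hRS
    set W : Set (JetSpace m) := regularSet S ∩ base ⁻¹' (S.source ∩ S ⁻¹' N) with hW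
    have hWo : IsOpen W := hreg.isOpen.inter
      ((S.isOpen_inter_preimage hNo).preimage continuous_base)
    have hregW : RegularOn S W := hreg.mono Set.inter_subset_left hWo
    have hz₀W : prolongMap S.symm z₀ ∈ W := by
      refine ⟨hPz₀, hPz₀.1, ?_⟩
      change S (prolongMap S.symm z₀).base ∈ N
      rw [prolongMap_base, S.right_inv hb]
      exact hbN
    filter_upwards [hWo.mem_nhds hz₀W,
      hP'.continuousAt.eventually (by
        rw [hinv z₀ hz₀]
        exact (hV.mem_nhds hzV : ∀ᶠ z in 𝓝 z₀, z ∈ V)),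
      hP'.continuousAt.eventually hGz₀.eventually, hGbar.eventually] with z hzW hzV hGz hGbz h0
    obtain ⟨K, hK⟩ := exists_lineDeriv_eq_sum_partialJet hGbz
    have hzero : ∀ J : MultiIdx m K, partialJet 1 J.1 (fun z => G (prolongMap S z)) z = 0 := by
      refine eq_zero_of_sum_monomials_eq_zero
        (c := fun J => partialJet 1 J.1 (fun z => G (prolongMap S z)) z) fun t => ?_
      -- The factor must be smooth on all of `B`, while `S.symm` is smooth only on `S.target`. The
      -- global `R` agrees with `S.symm` near the base point, which is all that is used on `W`. As
      -- `V` does not depend on the factor, all `t` can be tested at the same jet.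
      have hc : ContDiff ℝ ∞ fun b => expX t (R b) := (contDiff_expX t).comp hR
      have h1 := hsymm _ hc.contDiffOn _ hzV h0
      have key := hregW.applyField_prolongMap (v := fun b => expX t (R b) • v b) (c := expX t)
        (fun y hy => Filter.Eventually.of_forall fun b => (contDiff_expX t).contDiffAt)
        (fun y hy => eventually_contDiffAt hB (hc.contDiffOn.smul hv)
          (hSB (S.map_source hy.1.1)))
        (fun y hy => by
          have h2 : R (S y.base) = y.base := by
            rw [hN _ hy.2.2, S.left_inv hy.1.1]
          simp only [h2]
          rw [hSv _ hy.1.1]) hzW hGz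
      rw [h1, hK _ (prolongField_verticalField_fst _ _)
        (prolongField_verticalField_snd_zero _ _)] at key
      simp only [prolongField_verticalField_snd_one, multiPow_totalDeriv_expX] at key
      have h3 : expX t z.base ≠ 0 := (Real.exp_pos _).ne'
      have h4 : expX t z.base * ∑ J : MultiIdx m K, (∏ i, t i ^ J.1 i) *
          partialJet 1 J.1 (fun z => G (prolongMap S z)) z = 0 := by
        rw [Finset.mul_sum, key]
        exact Finset.sum_congr rfl fun J _ => by ring
      exact (mul_eq_zero.1 h4).resolve_left h3
    intro u hu1 hu2
    rw [hK u hu1 hu2]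
    exact Finset.sum_eq_zero fun J _ => by rw [hzero, mul_zero]

end Main

theorem mainTheorem2 {m k : ℕ} (hm : 1 ≤ m) (Ω : Set (Jet m k)) (hΩ : IsOpen Ω)
    (Δ β : Fin 2 → Jet m k → ℝ)
    (hΔ : ∀ i, ContDiffOn ℝ ∞ (Δ i) Ω) (hβ : ∀ i, ContDiffOn ℝ ∞ (β i) Ω)
    (hrank : ∀ p ∈ Ω, subsystem β Δ p = 0 → fderiv ℝ (subsystem β Δ) p ≠ 0)
    (z₀ : JetSpace m) (hz₀ : z₀.trunc k ∈ Ω) :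
    IsDecouplableAt (fun z => subsystem β Δ (z.trunc k)) z₀ ↔
      AdmitsArbitrarySymmetryAt (fun z => subsystem β Δ (z.trunc k)) z₀ := by
  have hg : ∀ᶠ p in 𝓝 (z₀.trunc k), ContDiffAt ℝ ∞ (subsystem β Δ) p :=
    eventually_contDiffAt hΩ (contDiffOn_subsystem hΔ hβ) hz₀
  have hG : IsSmoothAt (fun z => subsystem β Δ (z.trunc k)) z₀ := isSmoothAt_comp_trunc hg
  refine ⟨fun h => h.admitsArbitrarySymmetryAt hG, fun h => h.isDecouplableAt hG fun h0 => ?_⟩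
  by_contra! hcon
  -- Each finite jet direction extends by `0` to an infinite one. If all line derivatives vanished,
  -- so would the differential of the sub-system.
  refine hrank _ hz₀ h0 (ContinuousLinearMap.ext fun p => ?_)
  have h1 := hcon (extendJet k 0 p)
  rw [(hasLineDerivAt_of_eventuallyEq_trunc (hg.self_of_nhds.differentiableAt (by simp))
    Filter.EventuallyEq.rfl _).lineDeriv, trunc_extendJet] at h1
  exact h1
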